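/- Let $d\ge1$, $H\in(0,1)$, and let $X=\{X_t=(X^1_t,\dots,X^d_t):t\ge0\}$ be a (jointly measurable) $\mathbb R^d$-valued process whose components are i.i.d. one-dimensional self-similar Gaussian processes with Hurst index $H$ satisfying the following local non-determinism: for every $n\ge1$ there is a constant $\kappa_{H,n}>0$ such that $$\operatorname{Var}\Big(\sum_{j=1}^n a_j\,(X^1_{t_j}-X^1_{t_{j-1}})\Big)\ \ge\ \kappa_{H,n}\sum_{j=1}^n |a_j|^2\,(t_j-t_{j-1})^{2H}$$ for all $a_1,\dots,a_n\in\mathbb R$ and $0=t_0<t_1<\dots<t_n<\infty$. For a multi-index $\boldsymbol k\in\mathbb N_0^d$ write $|\boldsymbol k|=k_1+\dots+k_d$ and $g^{(\boldsymbol k)}=\partial_1^{k_1}\cdots\partial_d^{k_d}g$; let $p_\varepsilon(y)=(2\pi\varepsilon)^{-d/2}e^{-|y|^2/(2\varepsilon)}$ be the heat kernel on $\mathbb R^d$. For $T>0$ and $x\in\mathbb R^d$, the derivative of order $\boldsymbol k$ of the local time, $L^{(\boldsymbol k)}(T,x)$, is the limit of $L^{(\boldsymbol k)}_\varepsilon(T,x)=\int_0^T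 p_\varepsilon^{(\boldsymbol k)}(X_t+x)\,dt$ as $\varepsilon\downarrow0$, in $L^p$ for every $p\in[1,\infty)$. For $N\ge1$ let $\widetilde{\mathcal S}_{d,N}$ be the set of the complex-valued Schwartz functions $f$ on $\mathbb R^d$ with $\int_{\mathbb R^d} v_{i_1}\cdots v_{i_m}f(v)\,dv=0$ for all $1\le m\le N-1$ and $i_1,\dots,i_m\in\{1,\dots,d\}$ (so $\widetilde{\mathcal S}_{d,1}=\mathcal S(\mathbb R^d)$), and let $\widehat f(y)=\int_{\mathbb R^d}f(u)e^{-\iota y\cdot u}\,du$, where $\iota=\sqrt{-1}$. Let $N\ge1$ be an integer and let $\boldsymbol k\in\mathbb N_0^d$ satisfy $H(2|\boldsymbol k|+d)<1-2NH$. Then for all $T>0$ and $x\in\mathbb R^d$ the limits $L^{(\boldsymbol k)}(T,x)$ and $L^{(\boldsymbol k+\boldsymbol e_{i_1}+\dots+\boldsymbol e_{i_N})}(T,x)$ exist, where $i_1,\dots,i_N\in\{1,\dots,d\}$ and $\boldsymbol e_i$ is the $i$-th unit vector, and for every $f\in\widetilde{\mathcal S}_{d,N}$ and every $p\in[1,\infty)$,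 as $\varepsilon\downarrow0$, $$\varepsilon^{-\frac N2}\Big(\varepsilon^{-\frac{|\boldsymbol k|+d}2}\int_0^T f^{(\boldsymbol k)}\big(\varepsilon^{-\frac12}(X_t+x)\big)dt-\widehat f(0)\,L^{(\boldsymbol k)}(T,x)\Big)\ \xrightarrow{\ L^p\ }\ \frac{(-1)^N}{N!}\sum_{i_1,\dots,i_N=1}^d L^{(\boldsymbol k+\boldsymbol e_{i_1}+\dots+\boldsymbol e_{i_N})}(T,x)\int_{\mathbb R^d}v_{i_1}\cdots v_{i_N}f(v)\,dv .$$ -/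

import Mathlib

open MeasureTheory ProbabilityTheory Filter Topology
open scoped NNReal ENNReal SchwartzMap

noncomputable section

namespace LocalTimeLimit

/-- The state space `ℝ^d` with its Euclidean norm. -/
abbrev Space (d : ℕ) : Type := EuclideanSpace ℝ (Fin d)

/-- The order `|k| = k₁ + ⋯ + k_d` of a multi-index. -/
def order {d : ℕ} (k : Fin d → ℕ) : ℕ := ∑ l, k l

/-- The partial derivative of `g` in the `i`-th coordinate direction. -/
def partialDeriv {d : ℕ} {V : Type*} [NormedAddCommGroup V] [NormedSpace ℝ V]
    (i : Fin d) (g : Space d → V) : Space d → V :=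
  fun y => lineDeriv ℝ g y (EuclideanSpace.single i 1)

/-- The mixed partial derivative `g^(k) = ∂₁^{k₁} ⋯ ∂_d^{k_d} g`. -/
def multiDeriv {d : ℕ} {V : Type*} [NormedAddCommGroup V] [NormedSpace ℝ V]
    (k : Fin d → ℕ) (g : Space d → V) : Space d → V :=
  (List.finRange d).foldr (fun i h => (partialDeriv i)^[k i] h) g

/-- The multi-index `k + e_{i₁} + ⋯ + e_{i_N}`. -/
def shiftIndex {d N : ℕ} (k : Fin d → ℕ) (i : Fin N → Fin d) : Fin d → ℕ :=
  k + ∑ j, Pi.single (i j) 1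

/-- The heat kernel `p_ε(y) = (2πε)^{-d/2} exp(-|y|²/(2ε))`. -/
def heatKernel {d : ℕ} (ε : ℝ) (y : Space d) : ℝ :=
  1 / (2 * Real.pi * ε) ^ ((d : ℝ) / 2) * Real.exp (-(1 / (2 * ε)) * ‖y‖ ^ 2)

/-- The Fourier transform `f̂(y) = ∫ f(u) e^{-i y·u} du`. -/
def fourierHat {d : ℕ} (f : Space d → ℂ) (y : Space d) : ℂ :=
  ∫ u, f u * Complex.exp (-Complex.I * ((inner ℝ y u : ℝ) : ℂ))

/-- The moment `∫ v_{i₁} ⋯ v_{i_m} f(v) dv`. -/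
def moment {d m : ℕ} (f : Space d → ℂ) (i : Fin m → Fin d) : ℂ :=
  ∫ v : Space d, (∏ j, ((v (i j) : ℝ) : ℂ)) * f v

/-- The space of the complex Schwartz functions on `ℝ^d` all of whose moments of the orders
`1, …, N - 1` vanish. -/
def schwartzVanishing (d N : ℕ) : Set 𝓢(Space d, ℂ) :=
  {f | ∀ m : ℕ, 1 ≤ m → m < N → ∀ i : Fin m → Fin d, moment f i = 0}

/-- Convergence in `L^p` of `F ε` to `G` as `ε ↓ 0`, where all the functions belong to `L^p`. -/
def TendstoLp {Ω V : Type*} [MeasurableSpace Ω] [NormedAddCommGroup V]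
    (P : Measure Ω) (p : ℝ≥0∞) (F : ℝ → Ω → V) (G : Ω → V) : Prop :=
  (∀ ε : ℝ, 0 < ε → MemLp (F ε) p P) ∧ MemLp G p P ∧
    Tendsto (fun ε : ℝ => eLpNorm (F ε - G) p P) (𝓝[>] 0) (𝓝 0)

/-- The class `G^H_d` of the processes `X = (X_t)_{t ≥ 0}` in `ℝ^d` whose components are i.i.d.
self-similar Gaussian processes with Hurst index `H`, subject to local non-determinism.
Joint measurability in time and chance is what gives a meaning to the time integrals. -/
structure MemG {Ω : Type*} [MeasurableSpace Ω] {d : ℕ} (H : ℝ) (X : ℝ≥0 → Ω → Space d)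
    (P : Measure Ω) : Prop where
  measurable : ∀ t, Measurable (X t)
  jointlyMeasurable : AEMeasurable (fun z : ℝ × Ω => X z.1.toNNReal z.2)
    ((volume.restrict (Set.Ici (0 : ℝ))).prod P)
  gaussian : ∀ l, IsGaussianProcess (fun t ω => X t ω l) P
  indep : iIndepFun (fun (l : Fin d) (ω : Ω) (t : ℝ≥0) => X t ω l) P
  identDistrib : ∀ l l' : Fin d,
    IdentDistrib (fun (ω : Ω) (t : ℝ≥0) => X t ω l) (fun (ω : Ω) (t : ℝ≥0) => X t ω l') P P
  selfSimilar : ∀ (l : Fin d) (c : ℝ≥0), 0 < c →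
    IdentDistrib (fun (ω : Ω) (t : ℝ≥0) => X (c * t) ω l)
      (fun (ω : Ω) (t : ℝ≥0) => (c : ℝ) ^ H * X t ω l) P P
  localNondeterminism : ∀ n : ℕ, 1 ≤ n → ∃ κ : ℝ, 0 < κ ∧
    ∀ (l : Fin d) (a : Fin n → ℝ) (t : Fin (n + 1) → ℝ≥0), t 0 = 0 → StrictMono t →
      κ * ∑ j : Fin n, |a j| ^ 2 * ((t j.succ : ℝ) - (t j.castSucc : ℝ)) ^ (2 * H) ≤
        Var[fun ω => ∑ j : Fin n, a j * (X (t j.succ) ω l - X (t j.castSucc) ω l); P]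

/-- The approximation `L_ε^(k)(T,x) = ∫_0^T p_ε^(k)(X_t + x) dt`. -/
def localTimeApprox {Ω : Type*} {d : ℕ} (X : ℝ≥0 → Ω → Space d) (k : Fin d → ℕ)
    (T : ℝ) (x : Space d) (ε : ℝ) (ω : Ω) : ℝ :=
  ∫ t in (0 : ℝ)..T, multiDeriv k (heatKernel ε) (X t.toNNReal ω + x)

/-- `L` is (a version of) the derivative of order `k` of the local time of `X`: it is the limit of
the approximations `L_ε^(k)(T,x)` in `L^p` for every `p ∈ [1, ∞)`. -/
def IsLocalTimeDeriv {Ω : Type*} [MeasurableSpace Ω] {d : ℕ} (P : Measure Ω)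
    (X : ℝ≥0 → Ω → Space d) (k : Fin d → ℕ) (T : ℝ) (x : Space d) (L : Ω → ℝ) : Prop :=
  ∀ p : ℝ≥0∞, 1 ≤ p → p ≠ ⊤ → TendstoLp P p (localTimeApprox X k T x) L

open Classical in
/-- The derivative `L^(k)(T,x)` of the local time of `X`: the limit (unique up to null sets) of the
approximations, where it exists, and zero otherwise. -/
def localTimeDeriv {Ω : Type*} [MeasurableSpace Ω] {d : ℕ} (P : Measure Ω)
    (X : ℝ≥0 → Ω → Space d) (k : Fin d → ℕ) (T : ℝ) (x : Space d) : Ω → ℝ :=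
  if h : ∃ L, IsLocalTimeDeriv P X k T x L then h.choose else 0

end LocalTimeLimit

end

open LocalTimeLimit

/-! Everything is read off on the Fourier side. A function `φ(y) = ∫ h(ξ) e^{iξ·y} dξ` yields the
functional `∫_0^T φ(X_t + x) dt`. With `s = √ε`, the scaled derivative of `f` has the density
`(2π)^{-d} (iξ)^k f̂(sξ)`, and `p_ε^(k)` has the density `(2π)^{-d} (iξ)^k e^{-ε|ξ|²/2}`. Hence
`L^(k)` is the functional with the non-integrable density `(2π)^{-d} (iξ)^k`, understood as a limit
under Gaussian damping. On the level of densities the theorem is the Taylor expansion of `f̂` at the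
origin (`fourierHat_taylor`): the moments of orders `1, …, N - 1` vanish, so `s^{-N} (f̂(sξ) -
f̂(0))` converges to the term of order `N`.

To pass from densities to `L^p`, the moment of order `2m` is bounded by an integral over `2m` times
and frequencies of a product of values of `|h|` against the modulus of the joint characteristic
function. If that integral is finite for every number of factors with a weight `w` in place of
`|h|`, then dominated convergence applies: densities that are bounded by `M w` and tend to zero
pointwise have functionals tending to zero in every `L^p`, `p < ∞`
(`IsMomentWeight.tendsto_eLpNorm_occ`). The existence of `L^(k)` and the expansion are two instances
of this principle.

It remains to see that `w = (1 + |ξ|)^q` is such a weight (`MemG.isMomentWeight`). At ordered times,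
local non-determinism and the independence of the components bound the characteristic function by `∏
exp(-c (t_j - t_{j-1})^{2H} |η_j|²)`, where `η_j = ξ_j + ⋯ + ξ_n`. The product of the weights is at
most `∏ (1 + |η_j|)^{2q}`, and the change of variables to increments and tail sums has Jacobian one.
The integral thus factorises into powers of `∫_0^T ∫ (1 + |η|)^{2q} exp(-c s^{2H} |η|²) dη ds`. The
inner integral is at most a constant times `s^{-H(2q+d)}`, so all is finite if `H(2q + d) < 1`. For
`q = |k| + N` this is the hypothesis of the theorem. -/

noncomputable section

namespace LocalTimeLimit

/-- The function `y ↦ ∫ h(ξ) e^{i ξ·y} dξ` with the Fourier density `h`. -/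
def fourierSynth {d : ℕ} (h : Space d → ℂ) (y : Space d) : ℂ :=
  ∫ ξ, h ξ * Complex.exp (Complex.I * ((inner ℝ ξ y : ℝ) : ℂ))

/-- The additive functional `∫ φ(U_t) dμ(t)`, where `φ` has the Fourier density `h`. -/
def occ {Ω : Type*} {d : ℕ} (μ : Measure ℝ) (U : ℝ → Ω → Space d) (h : Space d → ℂ) (ω : Ω) : ℂ :=
  ∫ t, fourierSynth h (U t ω) ∂μ

/-- The joint characteristic function of `U` at the times `(z j).1` and frequencies `(z j).2`. -/
def jointChar {Ω ι : Type*} [MeasurableSpace Ω] [Fintype ι] {d : ℕ} (P : Measure Ω)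
    (U : ℝ → Ω → Space d) (z : ι → ℝ × Space d) : ℂ :=
  ∫ ω, Complex.exp (Complex.I * ((∑ j, inner ℝ (z j).2 (U (z j).1 ω) : ℝ) : ℂ)) ∂P

/-! ### Additive functionals with integrable Fourier density, and their moments -/

section Occupation

variable {Ω : Type*} [MeasurableSpace Ω] {d : ℕ} {P : Measure Ω} {μ : Measure ℝ}
  {U : ℝ → Ω → Space d}

lemma norm_cexp_I_mul_ofReal (x : ℝ) : ‖Complex.exp (Complex.I * (x : ℂ))‖ = 1 := by
  rw [mul_comm, Complex.norm_exp_ofReal_mul_I]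

lemma integrable_mul_cexp {α : Type*} [MeasurableSpace α] {ν : Measure α} {h : α → ℂ}
    (hh : Integrable h ν) {g : α → ℝ} (hg : Measurable g) :
    Integrable (fun a => h a * Complex.exp (Complex.I * ((g a : ℝ) : ℂ))) ν := by
  refine hh.mono (hh.1.mul ?_) (ae_of_all _ fun a => ?_)
  · exact (Complex.measurable_exp.comp
      (measurable_const.mul (Complex.measurable_ofReal.comp hg))).aestronglyMeasurable
  · rw [norm_mul, norm_cexp_I_mul_ofReal, mul_one]

lemma continuous_fourierSynth {h : Space d → ℂ} (hh : Integrable h) :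
    Continuous (fourierSynth h) := by
  unfold fourierSynth
  refine continuous_of_dominated (bound := fun ξ => ‖h ξ‖) (fun y => ?_) (fun y => ?_) hh.norm ?_
  · exact (integrable_mul_cexp hh (by fun_prop)).1
  · exact ae_of_all _ fun ξ => by rw [norm_mul, norm_cexp_I_mul_ofReal, mul_one]
  · exact ae_of_all _ fun ξ => by fun_prop

lemma norm_fourierSynth_le (h : Space d → ℂ) (y : Space d) :
    ‖fourierSynth h y‖ ≤ ∫ ξ, ‖h ξ‖ := by
  refine (norm_integral_le_integral_norm _).trans_eq (integral_congr_ae (ae_of_all _ fun ξ => ?_))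
  simp only [norm_mul, norm_cexp_I_mul_ofReal, mul_one]

lemma fourierSynth_sub {h g : Space d → ℂ} (hh : Integrable h) (hg : Integrable g) (y : Space d) :
    fourierSynth (h - g) y = fourierSynth h y - fourierSynth g y := by
  unfold fourierSynth
  rw [← integral_sub (integrable_mul_cexp hh (by fun_prop)) (integrable_mul_cexp hg (by fun_prop))]
  simp only [Pi.sub_apply, sub_mul]

lemma fourierSynth_const_mul (c : ℂ) (h : Space d → ℂ) (y : Space d) :
    fourierSynth (fun ξ => c * h ξ) y = c * fourierSynth h y := by
  unfold fourierSynth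
  rw [← integral_const_mul]
  simp only [mul_assoc]

/-- Conjugation stays within the class of syntheses, so that `|·|^{2m}` of an additive functional is
again a product of `2m` additive functionals. -/
lemma star_fourierSynth (h : Space d → ℂ) (y : Space d) :
    starRingEnd ℂ (fourierSynth h y) = fourierSynth (fun ξ => starRingEnd ℂ (h (-ξ))) y := by
  unfold fourierSynth
  rw [← integral_conj, ← integral_neg_eq_self]
  congr 1 with ξ
  simp [← Complex.exp_conj, inner_neg_left]

lemma integrable_fourierSynth_comp [IsFiniteMeasure μ]
    (hU : Measurable (fun z : ℝ × Ω => U z.1 z.2)) {h : Space d → ℂ} (hh : Integrable h) (ω : Ω) :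
    Integrable (fun t => fourierSynth h (U t ω)) μ := by
  refine (integrable_const (∫ ξ, ‖h ξ‖)).mono' ?_ (ae_of_all _ fun t => norm_fourierSynth_le h _)
  exact ((continuous_fourierSynth hh).measurable.comp
    (hU.comp (measurable_id.prodMk measurable_const))).aestronglyMeasurable

lemma occ_sub [IsFiniteMeasure μ]
    (hU : Measurable (fun z : ℝ × Ω => U z.1 z.2)) {h g : Space d → ℂ} (hh : Integrable h)
    (hg : Integrable g) : occ μ U (h - g) = occ μ U h - occ μ U g := by
  ext ω
  simp only [occ, Pi.sub_apply, fourierSynth_sub hh hg]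
  exact integral_sub (integrable_fourierSynth_comp hU hh ω) (integrable_fourierSynth_comp hU hg ω)

omit [MeasurableSpace Ω] in
lemma occ_const_mul (c : ℂ) (h : Space d → ℂ) :
    occ μ U (fun ξ => c * h ξ) = fun ω => c * occ μ U h ω := by
  ext ω
  simp only [occ, fourierSynth_const_mul, integral_const_mul]

omit [MeasurableSpace Ω] in
lemma star_occ (h : Space d → ℂ) (ω : Ω) :
    starRingEnd ℂ (occ μ U h ω) = occ μ U (fun ξ => starRingEnd ℂ (h (-ξ))) ω := by
  simp only [occ, ← integral_conj, star_fourierSynth]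

lemma measurable_occ [IsFiniteMeasure μ]
    (hU : Measurable (fun z : ℝ × Ω => U z.1 z.2)) {h : Space d → ℂ} (hh : Integrable h) :
    Measurable (occ μ U h) := by
  unfold occ
  refine StronglyMeasurable.measurable ?_
  refine StronglyMeasurable.integral_prod_right (f := fun ω t => fourierSynth h (U t ω)) ?_
  exact ((continuous_fourierSynth hh).measurable.comp
    (hU.comp measurable_swap)).stronglyMeasurable

omit [MeasurableSpace Ω] in
lemma norm_occ_le [IsFiniteMeasure μ] (h : Space d → ℂ) (ω : Ω) :
    ‖occ μ U h ω‖ ≤ (∫ ξ, ‖h ξ‖) * μ.real Set.univ :=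
  norm_integral_le_of_norm_le_const (ae_of_all _ fun _ => norm_fourierSynth_le h _)

lemma memLp_occ [IsFiniteMeasure P] [IsFiniteMeasure μ]
    (hU : Measurable (fun z : ℝ × Ω => U z.1 z.2)) {h : Space d → ℂ} (hh : Integrable h)
    (p : ℝ≥0∞) : MemLp (occ μ U h) p P :=
  MemLp.of_bound (measurable_occ hU hh).aestronglyMeasurable _ (ae_of_all _ (norm_occ_le h))

lemma occ_eq_integral_prod [IsFiniteMeasure μ]
    (hU : Measurable (fun z : ℝ × Ω => U z.1 z.2)) {h : Space d → ℂ} (hh : Integrable h) (ω : Ω) :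
    occ μ U h ω = ∫ z, h z.2 * Complex.exp (Complex.I * ((inner ℝ z.2 (U z.1 ω) : ℝ) : ℂ))
      ∂(μ.prod volume) := by
  rw [integral_prod]
  · rfl
  · refine integrable_mul_cexp (Integrable.comp_snd hh μ) ?_
    exact measurable_snd.inner (hU.comp (measurable_fst.prodMk measurable_const))

lemma measurable_jointPhase {ι : Type*} [Fintype ι]
    (hU : Measurable (fun z : ℝ × Ω => U z.1 z.2)) :
    Measurable (fun q : Ω × (ι → ℝ × Space d) =>
      ∑ j, inner ℝ (q.2 j).2 (U (q.2 j).1 q.1)) := by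
  refine Finset.measurable_fun_sum _ fun j _ => ?_
  have hj : Measurable (fun q : Ω × (ι → ℝ × Space d) => q.2 j) :=
    (measurable_pi_apply j).comp measurable_snd
  have hUj : Measurable (fun q : Ω × (ι → ℝ × Space d) => U (q.2 j).1 q.1) :=
    hU.comp (hj.fst.prodMk measurable_fst)
  exact Measurable.inner (𝕜 := ℝ) hj.snd hUj

lemma measurable_jointChar [SFinite P] {ι : Type*} [Fintype ι]
    (hU : Measurable (fun z : ℝ × Ω => U z.1 z.2)) :
    Measurable (jointChar (ι := ι) P U) := by
  have h1 : StronglyMeasurable (Function.uncurry fun (z : ι → ℝ × Space d) (ω : Ω) =>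
      Complex.exp (Complex.I * ((∑ j, inner ℝ (z j).2 (U (z j).1 ω) : ℝ) : ℂ))) :=
    (Complex.measurable_exp.comp (measurable_const.mul (Complex.measurable_ofReal.comp
      ((measurable_jointPhase hU).comp measurable_swap)))).stronglyMeasurable
  exact (h1.integral_prod_right (ν := P)).measurable

/-- The mixed moments of additive functionals are bounded by means of the joint characteristic
functions. -/
lemma enorm_integral_prod_occ_le [IsFiniteMeasure P] [IsFiniteMeasure μ] {ι : Type*} [Fintype ι]
    (hU : Measurable (fun z : ℝ × Ω => U z.1 z.2)) {h : ι → Space d → ℂ}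
    (hh : ∀ j, Integrable (h j)) :
    ‖∫ ω, ∏ j, occ μ U (h j) ω ∂P‖ₑ ≤
      ∫⁻ z : ι → ℝ × Space d, (∏ j, ‖h j (z j).2‖ₑ) * ‖jointChar P U z‖ₑ
        ∂(Measure.pi fun _ => μ.prod volume) := by
  have h1 : ∀ ω, ∏ j, occ μ U (h j) ω = ∫ z : ι → ℝ × Space d,
      (∏ j, h j (z j).2) *
        Complex.exp (Complex.I * ((∑ j, inner ℝ (z j).2 (U (z j).1 ω) : ℝ) : ℂ))
        ∂(Measure.pi fun _ => μ.prod volume) := by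
    intro ω
    rw [Finset.prod_congr rfl fun j _ => occ_eq_integral_prod hU (hh j) ω,
      ← integral_fintype_prod_eq_prod]
    congr 1 with z
    rw [Finset.prod_mul_distrib, Complex.ofReal_sum, Finset.mul_sum, Complex.exp_sum]
  simp_rw [h1]
  -- Fubini is available because the densities are integrable and the phases have modulus one.
  rw [integral_integral_swap]
  · refine (enorm_integral_le_lintegral_enorm _).trans_eq (lintegral_congr fun z => ?_)
    rw [integral_const_mul, enorm_mul, ← ofReal_norm (∏ j, _), norm_prod,
      ENNReal.ofReal_prod_of_nonneg fun _ _ => norm_nonneg _]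
    simp only [ofReal_norm]
    rfl
  · refine integrable_mul_cexp (h := fun q : Ω × (ι → ℝ × Space d) => ∏ j, h j (q.2 j).2) ?_
      (measurable_jointPhase hU)
    refine Integrable.comp_snd (f := fun z : ι → ℝ × Space d => ∏ j, h j (z j).2) ?_ P
    exact Integrable.fintype_prod (f := fun j (z : ℝ × Space d) => h j z.2)
      fun j => (hh j).comp_snd μ

/-- The even moments of an additive functional are bounded by means of the joint characteristic
functions. -/
lemma lintegral_enorm_occ_pow_le [IsFiniteMeasure P] [IsFiniteMeasure μ] (m : ℕ)
    (hU : Measurable (fun z : ℝ × Ω => U z.1 z.2)) {h : Space d → ℂ} (hh : Integrable h) :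
    ∫⁻ ω, ‖occ μ U h ω‖ₑ ^ (m + m) ∂P ≤
      ∫⁻ z : Fin (m + m) → ℝ × Space d,
        (∏ j, (‖h (z j).2‖ₑ + ‖h (-(z j).2)‖ₑ)) * ‖jointChar P U z‖ₑ
        ∂(Measure.pi fun _ => μ.prod volume) := by
  set g : Space d → ℂ := fun ξ => starRingEnd ℂ (h (-ξ)) with hg_def
  have hg : Integrable g := by
    refine (hh.comp_neg).mono (Complex.continuous_conj.comp_aestronglyMeasurable hh.comp_neg.1)
      (ae_of_all _ fun ξ => ?_)
    simp [hg_def]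
  -- Half of the factors carry `h` and half its conjugate reflection, so the product is `|·|^{2m}`.
  -- The sum `|h(ξ)| + |h(-ξ)|` dominates both kinds and keeps the bound symmetric in the factors.
  set k : Fin (m + m) → Space d → ℂ := Fin.addCases (fun _ => h) (fun _ => g) with hk_def
  have hk : ∀ j, Integrable (k j) := by
    intro j
    refine Fin.addCases (fun i => ?_) (fun i => ?_) j
    · simpa only [hk_def, Fin.addCases_left] using hh
    · simpa only [hk_def, Fin.addCases_right] using hg
  have hprod : ∀ ω, ∏ j, occ μ U (k j) ω = ((‖occ μ U h ω‖ ^ (m + m) : ℝ) : ℂ) := by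
    intro ω
    rw [Fin.prod_univ_add]
    simp only [hk_def, Fin.addCases_left, Fin.addCases_right, Finset.prod_const, Finset.card_univ,
      Fintype.card_fin]
    rw [hg_def, ← star_occ, ← mul_pow, Complex.mul_conj']
    push_cast
    rw [← pow_mul, two_mul]
  have hint : Integrable (fun ω => ‖occ μ U h ω‖ ^ (m + m)) P := by
    refine Integrable.of_bound ((measurable_occ hU hh).norm.pow_const _).aestronglyMeasurable
      (((∫ ξ, ‖h ξ‖) * μ.real Set.univ) ^ (m + m)) (ae_of_all _ fun ω => ?_)
    rw [norm_pow, norm_norm]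
    exact pow_le_pow_left₀ (norm_nonneg _) (norm_occ_le h ω) _
  calc ∫⁻ ω, ‖occ μ U h ω‖ₑ ^ (m + m) ∂P
      = ∫⁻ ω, ENNReal.ofReal (‖occ μ U h ω‖ ^ (m + m)) ∂P := by
        refine lintegral_congr fun ω => ?_
        rw [ENNReal.ofReal_pow (norm_nonneg _), ofReal_norm]
    _ = ENNReal.ofReal (∫ ω, ‖occ μ U h ω‖ ^ (m + m) ∂P) :=
        (ofReal_integral_eq_lintegral_ofReal hint
          (ae_of_all _ fun ω => by positivity)).symm
    _ = ‖∫ ω, ∏ j, occ μ U (k j) ω ∂P‖ₑ := by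
        simp_rw [hprod]
        rw [integral_complex_ofReal, ← ofReal_norm, Complex.norm_real, Real.norm_of_nonneg]
        exact integral_nonneg fun ω => by positivity
    _ ≤ _ := by
        refine (enorm_integral_prod_occ_le hU hk).trans (lintegral_mono fun z => ?_)
        gcongr with j _
        refine Fin.addCases (fun i => ?_) (fun i => ?_) j
        · simp only [hk_def, Fin.addCases_left, le_self_add]
        · simp only [hk_def, Fin.addCases_right, hg_def, ← ofReal_norm, RCLike.norm_conj,
            le_add_self]

end Occupation

/-! ### Calculus of `L^p` limits as `ε ↓ 0` -/

section LpLimits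

variable {Ω V : Type*} [MeasurableSpace Ω] [NormedAddCommGroup V] {P : Measure Ω} {p : ℝ≥0∞}
  {F F' : ℝ → Ω → V} {G G' : Ω → V}

lemma TendstoLp.unique (hp : 1 ≤ p) (h : TendstoLp P p F G) (h' : TendstoLp P p F G') :
    G =ᵐ[P] G' := by
  have h0 : Tendsto (fun ε => eLpNorm (F ε - G) p P + eLpNorm (F ε - G') p P) (𝓝[>] 0) (𝓝 0) := by
    simpa using h.2.2.add h'.2.2
  have h1 : eLpNorm (G - G') p P ≤ 0 := by
    refine ge_of_tendsto h0 ?_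
    filter_upwards [self_mem_nhdsWithin] with ε hε
    have h2 : G - G' = (F ε - G') - (F ε - G) := by abel
    rw [h2, add_comm]
    exact eLpNorm_sub_le ((h.1 ε hε).1.sub h'.2.1.1) ((h.1 ε hε).1.sub h.2.1.1) hp
  rw [nonpos_iff_eq_zero, eLpNorm_eq_zero_iff (h.2.1.1.sub h'.2.1.1) (by positivity)] at h1
  filter_upwards [h1] with ω hω
  exact sub_eq_zero.mp hω

lemma TendstoLp.congr (hF : ∀ ε, 0 < ε → F ε =ᵐ[P] F' ε) (hG : G =ᵐ[P] G')
    (h : TendstoLp P p F G) : TendstoLp P p F' G' := by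
  refine ⟨fun ε hε => (h.1 ε hε).ae_eq (hF ε hε), h.2.1.ae_eq hG, h.2.2.congr' ?_⟩
  filter_upwards [self_mem_nhdsWithin] with ε hε
  exact eLpNorm_congr_ae ((hF ε hε).sub hG)

lemma TendstoLp.sub (hp : 1 ≤ p) (h : TendstoLp P p F G) (h' : TendstoLp P p F' G') :
    TendstoLp P p (fun ε => F ε - F' ε) (G - G') := by
  refine ⟨fun ε hε => (h.1 ε hε).sub (h'.1 ε hε), h.2.1.sub h'.2.1, ?_⟩
  have h0 : Tendsto (fun ε => eLpNorm (F ε - G) p P + eLpNorm (F' ε - G') p P) (𝓝[>] 0)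
      (𝓝 0) := by
    simpa using h.2.2.add h'.2.2
  refine tendsto_of_tendsto_of_tendsto_of_le_of_le' tendsto_const_nhds h0
    (Eventually.of_forall fun _ => zero_le) ?_
  filter_upwards [self_mem_nhdsWithin] with ε hε
  have h2 : F ε - F' ε - (G - G') = (F ε - G) - (F' ε - G') := by abel
  rw [h2]
  exact eLpNorm_sub_le ((h.1 ε hε).1.sub h.2.1.1) ((h'.1 ε hε).1.sub h'.2.1.1) hp

lemma TendstoLp.const_mul {F : ℝ → Ω → ℂ} {G : Ω → ℂ} (h : TendstoLp P p F G) (c : ℂ) :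
    TendstoLp P p (fun ε ω => c * F ε ω) (fun ω => c * G ω) := by
  refine ⟨fun ε hε => (h.1 ε hε).const_mul c, h.2.1.const_mul c, ?_⟩
  have h0 : Tendsto (fun ε => ‖c‖ₑ * eLpNorm (F ε - G) p P) (𝓝[>] 0) (𝓝 0) := by
    simpa using ENNReal.Tendsto.const_mul h.2.2 (Or.inr (enorm_ne_top (x := c)))
  refine h0.congr fun ε => ?_
  rw [← eLpNorm_const_smul]
  congr 1 with ω
  simp [mul_sub]

lemma TendstoLp.mono_exponent [IsProbabilityMeasure P] {q : ℝ≥0∞} (hqp : q ≤ p)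
    (h : TendstoLp P p F G) : TendstoLp P q F G := by
  refine ⟨fun ε hε => (h.1 ε hε).mono_exponent hqp, h.2.1.mono_exponent hqp, ?_⟩
  refine tendsto_of_tendsto_of_tendsto_of_le_of_le' tendsto_const_nhds h.2.2
    (Eventually.of_forall fun _ => zero_le) ?_
  filter_upwards [self_mem_nhdsWithin] with ε hε
  exact eLpNorm_le_eLpNorm_of_exponent_le hqp ((h.1 ε hε).1.sub h.2.1.1)

/-- An eventual bound on the norms passes to the limit. -/
lemma TendstoLp.le_of_eventually_le (hp : 1 ≤ p) (h : TendstoLp P p F G) {c : ℝ≥0∞}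
    (hc : ∀ᶠ ε in 𝓝[>] 0, eLpNorm (F ε) p P ≤ c) : eLpNorm G p P ≤ c := by
  have h0 : Tendsto (fun ε => c + eLpNorm (F ε - G) p P) (𝓝[>] 0) (𝓝 c) := by
    simpa using tendsto_const_nhds.add h.2.2
  refine ge_of_tendsto h0 ?_
  filter_upwards [self_mem_nhdsWithin, hc] with ε hε hcε
  have h2 : G = F ε - (F ε - G) := by abel
  calc eLpNorm G p P = eLpNorm (F ε - (F ε - G)) p P := by rw [← h2]
    _ ≤ eLpNorm (F ε) p P + eLpNorm (F ε - G) p P :=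
      eLpNorm_sub_le (h.1 ε hε).1 ((h.1 ε hε).1.sub h.2.1.1) hp
    _ ≤ _ := by gcongr

lemma exists_tendstoLp_of_cauchy [CompleteSpace V] (hp : 1 ≤ p)
    (hF : ∀ ε, 0 < ε → MemLp (F ε) p P)
    (hC : Tendsto (fun q : ℝ × ℝ => eLpNorm (F q.1 - F q.2) p P) (𝓝[>] 0 ×ˢ 𝓝[>] 0) (𝓝 0)) :
    ∃ G, TendstoLp P p F G := by
  have : Fact (1 ≤ p) := ⟨hp⟩
  classical
  -- The value zero for `ε ≤ 0` is a default that the filter `𝓝[>] 0` never sees.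
  set f : ℝ → Lp V p P := fun ε => if h : 0 < ε then (hF ε h).toLp (F ε) else 0 with hf
  have hfc : ∀ ε, 0 < ε → (f ε : Ω → V) =ᵐ[P] F ε := by
    intro ε hε
    simp only [hf, hε, dif_pos]
    exact MemLp.coeFn_toLp _
  have hcau : Cauchy (map f (𝓝[>] 0)) := by
    rw [cauchy_map_iff]
    refine ⟨inferInstance, ?_⟩
    rw [tendsto_uniformity_iff_dist_tendsto_zero]
    have h1 := (ENNReal.tendsto_toReal ENNReal.zero_ne_top).comp hC
    refine h1.congr' ?_
    have hpos : ∀ᶠ ε : ℝ in 𝓝[>] 0, 0 < ε := self_mem_nhdsWithin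
    filter_upwards [hpos.prod_mk hpos] with q hq
    have h2 : eLpNorm (F q.1 - F q.2) p P = eLpNorm (⇑(f q.1) - ⇑(f q.2)) p P :=
      eLpNorm_congr_ae ((hfc _ hq.1).sub (hfc _ hq.2)).symm
    simp only [Function.comp_apply, h2, Lp.dist_def]
  obtain ⟨G, hG⟩ := CompleteSpace.complete hcau
  refine ⟨G, hF, Lp.memLp G, ?_⟩
  have h2 : Tendsto f (𝓝[>] 0) (𝓝 G) := hG
  rw [Lp.tendsto_Lp_iff_tendsto_eLpNorm'] at h2
  refine h2.congr' ?_
  filter_upwards [self_mem_nhdsWithin] with ε hε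
  exact eLpNorm_congr_ae ((hfc ε hε).sub (ae_eq_refl _))

/-- The local time is real, whereas its Fourier representation is complex; this passes between the
two. -/
lemma tendstoLp_ofReal {F : ℝ → Ω → ℝ} {G : Ω → ℝ} :
    TendstoLp P p (fun ε ω => (F ε ω : ℂ)) (fun ω => (G ω : ℂ)) ↔ TendstoLp P p F G := by
  have h1 : ∀ g : Ω → ℝ, MemLp (fun ω => (g ω : ℂ)) p P ↔ MemLp g p P := fun g =>
    ⟨fun h => by simpa using h.re, fun h => h.ofReal⟩
  have h2 : ∀ g : Ω → ℝ, eLpNorm (fun ω => (g ω : ℂ)) p P = eLpNorm g p P := fun g =>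
    eLpNorm_congr_norm_ae (ae_of_all _ fun ω => by simp)
  have h3 : ∀ ε, (fun ω => (F ε ω : ℂ)) - (fun ω => (G ω : ℂ)) =
      fun ω => (((F ε - G) ω : ℝ) : ℂ) := fun ε => by
    ext ω; simp
  unfold TendstoLp
  simp only [h1, h3, h2]

end LpLimits

/-! ### Moment weights and functionals with non-integrable Fourier density -/

section GeneralizedOccupation

variable {Ω : Type*} [MeasurableSpace Ω] {d : ℕ}

/-- The weights `w` on the frequency space for which the moments of the additive functionals are
bounded uniformly over the Fourier densities dominated by `w`. -/
structure IsMomentWeight (P : Measure Ω) (μ : Measure ℝ) (U : ℝ → Ω → Space d)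
    (w : Space d → ℝ) : Prop where
  measurable : Measurable w
  nonneg : ∀ ξ, 0 ≤ w ξ
  even : ∀ ξ, w (-ξ) = w ξ
  integrable : ∀ δ : ℝ, 0 < δ → Integrable (fun ξ => Real.exp (-(δ / 2) * ‖ξ‖ ^ 2) * w ξ)
  lintegral_ne_top : ∀ n : ℕ, 1 ≤ n → ∫⁻ z : Fin n → ℝ × Space d,
    (∏ j, ENNReal.ofReal (w (z j).2)) * ‖jointChar P U z‖ₑ
      ∂(Measure.pi fun _ => μ.prod volume) ≠ ⊤

/-- The measurable Fourier densities dominated by a multiple of `w`. -/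
def IsDominated (w : Space d → ℝ) (Q : Space d → ℂ) : Prop :=
  Measurable Q ∧ ∃ M : ℝ, 0 ≤ M ∧ ∀ ξ, ‖Q ξ‖ ≤ M * w ξ

/-- The Fourier density `Q` damped by the Gaussian factor of variance `δ`. -/
def damp (δ : ℝ) (Q : Space d → ℂ) (ξ : Space d) : ℂ :=
  ((Real.exp (-(δ / 2) * ‖ξ‖ ^ 2) : ℝ) : ℂ) * Q ξ

/-- `L` is the additive functional with the possibly not integrable Fourier density `Q`. -/
def IsGenOcc (P : Measure Ω) (μ : Measure ℝ) (U : ℝ → Ω → Space d) (Q : Space d → ℂ)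
    (L : Ω → ℂ) : Prop :=
  ∀ p : ℝ≥0∞, 1 ≤ p → p ≠ ⊤ → TendstoLp P p (fun δ => occ μ U (damp δ Q)) L

variable {P : Measure Ω} {μ : Measure ℝ} {U : ℝ → Ω → Space d} {w : Space d → ℝ}
  {Q Q' : Space d → ℂ} {L L' : Ω → ℂ}

lemma IsDominated.sub (hQ : IsDominated w Q) (hQ' : IsDominated w Q') :
    IsDominated w (Q - Q') := by
  obtain ⟨hm, M, hM, hb⟩ := hQ
  obtain ⟨hm', M', hM', hb'⟩ := hQ'
  refine ⟨hm.sub hm', M + M', by positivity, fun ξ => ?_⟩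
  rw [add_mul]
  exact (norm_sub_le _ _).trans (add_le_add (hb ξ) (hb' ξ))

lemma IsDominated.const_mul (hQ : IsDominated w Q) (c : ℂ) :
    IsDominated w (fun ξ => c * Q ξ) := by
  obtain ⟨hm, M, hM, hb⟩ := hQ
  refine ⟨hm.const_mul c, ‖c‖ * M, by positivity, fun ξ => ?_⟩
  rw [norm_mul, mul_assoc]
  exact mul_le_mul_of_nonneg_left (hb ξ) (norm_nonneg c)

lemma measurable_damp (hQ : Measurable Q) (δ : ℝ) : Measurable (damp δ Q) := by
  unfold damp
  fun_prop

lemma norm_damp_le {δ : ℝ} (hδ : 0 ≤ δ) (ξ : Space d) : ‖damp δ Q ξ‖ ≤ ‖Q ξ‖ := by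
  rw [damp, norm_mul, Complex.norm_real, Real.norm_of_nonneg (Real.exp_pos _).le]
  refine mul_le_of_le_one_left (norm_nonneg _) (Real.exp_le_one_iff.mpr ?_)
  have : 0 ≤ δ / 2 * ‖ξ‖ ^ 2 := by positivity
  linarith

lemma tendsto_damp (Q : Space d → ℂ) (ξ : Space d) :
    Tendsto (fun δ => damp δ Q ξ) (𝓝[>] 0) (𝓝 (Q ξ)) := by
  have h : Continuous fun δ : ℝ => damp δ Q ξ := by unfold damp; fun_prop
  simpa [damp] using (h.tendsto 0).mono_left nhdsWithin_le_nhds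

lemma damp_sub (δ : ℝ) : damp δ (Q - Q') = damp δ Q - damp δ Q' := by
  ext ξ; simp [damp, mul_sub]

lemma damp_const_mul (δ : ℝ) (c : ℂ) :
    damp δ (fun ξ => c * Q ξ) = fun ξ => c * damp δ Q ξ := by
  ext ξ; simp only [damp]; ring

lemma IsMomentWeight.integrable_damp (hw : IsMomentWeight P μ U w) (hQ : IsDominated w Q)
    {δ : ℝ} (hδ : 0 < δ) : Integrable (damp δ Q) := by
  obtain ⟨hm, M, hM, hb⟩ := hQ
  refine ((hw.integrable δ hδ).const_mul M).mono' (measurable_damp hm δ).aestronglyMeasurable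
    (ae_of_all _ fun ξ => ?_)
  rw [damp, norm_mul, Complex.norm_real, Real.norm_of_nonneg (Real.exp_pos _).le]
  calc _ ≤ Real.exp (-(δ / 2) * ‖ξ‖ ^ 2) * (M * w ξ) := by gcongr; exact hb ξ
    _ = _ := by ring

/-- Dominated convergence for the moments of the additive functionals. -/
lemma IsMomentWeight.tendsto_eLpNorm_occ [IsProbabilityMeasure P] [IsFiniteMeasure μ]
    (hw : IsMomentWeight P μ U w) (hU : Measurable (fun z : ℝ × Ω => U z.1 z.2))
    {ι : Type*} {l : Filter ι} [l.IsCountablyGenerated] {h : ι → Space d → ℂ} {M : ℝ}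
    (hM : 0 ≤ M) (hm : ∀ᶠ i in l, Measurable (h i)) (hi : ∀ᶠ i in l, Integrable (h i))
    (hb : ∀ᶠ i in l, ∀ ξ, ‖h i ξ‖ ≤ M * w ξ) (hl : ∀ ξ, Tendsto (fun i => h i ξ) l (𝓝 0))
    {p : ℝ≥0∞} (hp : p ≠ ⊤) : Tendsto (fun i => eLpNorm (occ μ U (h i)) p P) l (𝓝 0) := by
  -- Only even moments are under control; under a probability measure they dominate every finite
  -- `p`. With `m ≥ 1` the product of factors tending to zero is not empty, so it tends to zero.
  obtain ⟨m, hm1, hpm⟩ : ∃ m : ℕ, 1 ≤ m ∧ p ≤ ((m + m : ℕ) : ℝ≥0∞) := by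
    obtain ⟨m, hm⟩ := ENNReal.exists_nat_gt hp
    refine ⟨m + 1, by omega, hm.le.trans ?_⟩
    exact_mod_cast (by omega : m ≤ m + 1 + (m + 1))
  have hpos : (0 : ℝ) < ((m + m : ℕ) : ℝ) := by exact_mod_cast (by omega : 0 < m + m)
  have hI : Tendsto (fun i => ∫⁻ z : Fin (m + m) → ℝ × Space d,
      (∏ j, (‖h i (z j).2‖ₑ + ‖h i (-(z j).2)‖ₑ)) * ‖jointChar P U z‖ₑ
        ∂(Measure.pi fun _ => μ.prod volume)) l (𝓝 0) := by
    have hz : (0 : ℝ≥0∞) = ∫⁻ _ : Fin (m + m) → ℝ × Space d, 0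
        ∂(Measure.pi fun _ => μ.prod volume) := by simp
    rw [hz]
    refine tendsto_lintegral_filter_of_dominated_convergence
      (fun z => ENNReal.ofReal (M + M) ^ (m + m) *
        ((∏ j, ENNReal.ofReal (w (z j).2)) * ‖jointChar P U z‖ₑ)) ?_ ?_ ?_ ?_
    · filter_upwards [hm] with i hmi
      have hj : Measurable (jointChar (ι := Fin (m + m)) P U) := measurable_jointChar hU
      fun_prop
    · filter_upwards [hb] with i hbi
      refine ae_of_all _ fun z => ?_
      rw [← mul_assoc]
      gcongr
      -- Each factor contributes `2M`: one `M` for `h(ξ)` and one for `h(-ξ)`, by the evenness of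
      -- `w`.
      have hc : ENNReal.ofReal (M + M) ^ (m + m) =
          ∏ _j : Fin (m + m), ENNReal.ofReal (M + M) := by simp
      rw [hc, ← Finset.prod_mul_distrib]
      gcongr with j _
      rw [← ENNReal.ofReal_mul (by positivity), add_mul,
        ENNReal.ofReal_add (mul_nonneg hM (hw.nonneg _)) (mul_nonneg hM (hw.nonneg _)),
        ← ofReal_norm, ← ofReal_norm]
      gcongr
      · exact hbi _
      · rw [← hw.even]; exact hbi _
    · rw [lintegral_const_mul' _ _ (by finiteness)]
      exact ENNReal.mul_ne_top (by finiteness) (hw.lintegral_ne_top (m + m) (by omega))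
    · refine ae_of_all _ fun z => ?_
      have h1 : ∀ j, Tendsto (fun i => ‖h i (z j).2‖ₑ + ‖h i (-(z j).2)‖ₑ) l (𝓝 0) := by
        intro j
        simpa using (hl (z j).2).enorm.add (hl (-(z j).2)).enorm
      have h2 := ENNReal.tendsto_finsetProd_of_ne_top (Finset.univ : Finset (Fin (m + m)))
        (fun j _ => h1 j) (fun _ _ => ENNReal.zero_ne_top)
      rw [Finset.prod_const, zero_pow (by simp; omega)] at h2
      simpa using ENNReal.Tendsto.mul_const h2 (Or.inr enorm_ne_top)
  have hle : ∀ᶠ i in l, eLpNorm (occ μ U (h i)) p P ≤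
      (∫⁻ z : Fin (m + m) → ℝ × Space d,
      (∏ j, (‖h i (z j).2‖ₑ + ‖h i (-(z j).2)‖ₑ)) * ‖jointChar P U z‖ₑ
        ∂(Measure.pi fun _ => μ.prod volume)) ^ (1 / ((m + m : ℕ) : ℝ)) := by
    filter_upwards [hi] with i hii
    refine (eLpNorm_le_eLpNorm_of_exponent_le hpm
      (measurable_occ hU hii).aestronglyMeasurable).trans ?_
    rw [eLpNorm_eq_lintegral_rpow_enorm_toReal (by exact_mod_cast (by omega : m + m ≠ 0))
      (ENNReal.natCast_ne_top _), ENNReal.toReal_natCast]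
    refine ENNReal.rpow_le_rpow ?_ (by positivity)
    simp only [ENNReal.rpow_natCast]
    exact lintegral_enorm_occ_pow_le m hU hii
  refine tendsto_of_tendsto_of_tendsto_of_le_of_le' tendsto_const_nhds ?_
    (Eventually.of_forall fun _ => zero_le) hle
  have h0 := (ENNReal.continuous_rpow_const (y := 1 / ((m + m : ℕ) : ℝ))).tendsto 0
  rw [ENNReal.zero_rpow_of_pos (by positivity)] at h0
  exact h0.comp hI

variable [IsProbabilityMeasure P] [IsFiniteMeasure μ]

/-- The damped densities differ by at most `2M w`, and their differences tend to zero pointwise as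
both dampings vanish. Dominated convergence makes the functionals Cauchy in each `L^p`, which is
complete. -/
lemma IsMomentWeight.exists_isGenOcc (hw : IsMomentWeight P μ U w)
    (hU : Measurable (fun z : ℝ × Ω => U z.1 z.2)) (hQ : IsDominated w Q) :
    ∃ L, IsGenOcc P μ U Q L := by
  have hpos : ∀ᶠ ε : ℝ in 𝓝[>] 0, 0 < ε := self_mem_nhdsWithin
  have hdamp : ∀ δ, 0 < δ → Integrable (damp δ Q) := fun δ hδ => hw.integrable_damp hQ hδ
  have key : ∀ p : ℝ≥0∞, 1 ≤ p → p ≠ ⊤ →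
      ∃ L, TendstoLp P p (fun δ => occ μ U (damp δ Q)) L := by
    intro p hp hp'
    refine exists_tendstoLp_of_cauchy hp (fun δ hδ => memLp_occ hU (hdamp δ hδ) p) ?_
    obtain ⟨hm, M, hM, hb⟩ := hQ
    have h1 : Tendsto (fun q : ℝ × ℝ => eLpNorm (occ μ U (damp q.1 Q - damp q.2 Q)) p P)
        (𝓝[>] 0 ×ˢ 𝓝[>] 0) (𝓝 0) := by
      refine hw.tendsto_eLpNorm_occ hU (M := M + M) (by positivity)
        (Eventually.of_forall fun q => (measurable_damp hm _).sub (measurable_damp hm _))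
        ?_ ?_ ?_ hp'
      · filter_upwards [hpos.prod_mk hpos] with q hq
        exact (hdamp _ hq.1).sub (hdamp _ hq.2)
      · filter_upwards [hpos.prod_mk hpos] with q hq ξ
        refine (norm_sub_le _ _).trans ?_
        rw [add_mul]
        exact add_le_add ((norm_damp_le hq.1.le ξ).trans (hb ξ))
          ((norm_damp_le hq.2.le ξ).trans (hb ξ))
      · intro ξ
        simpa using ((tendsto_damp Q ξ).comp tendsto_fst).sub
          ((tendsto_damp Q ξ).comp tendsto_snd)
    refine h1.congr' ?_
    filter_upwards [hpos.prod_mk hpos] with q hq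
    rw [occ_sub hU (hdamp _ hq.1) (hdamp _ hq.2)]
  -- The limit in `L^1` serves every `p`: convergence in `L^p` implies convergence in `L^1`, where
  -- the limit is unique almost everywhere.
  obtain ⟨L, hL⟩ := key 1 le_rfl ENNReal.one_ne_top
  refine ⟨L, fun p hp hp' => ?_⟩
  obtain ⟨L', hL'⟩ := key p hp hp'
  exact hL'.congr (fun _ _ => ae_eq_refl _) ((hL'.mono_exponent hp).unique le_rfl hL)

omit [IsProbabilityMeasure P] [IsFiniteMeasure μ] in
lemma IsGenOcc.memLp (h : IsGenOcc P μ U Q L) {p : ℝ≥0∞} (hp : 1 ≤ p) (hp' : p ≠ ⊤) :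
    MemLp L p P :=
  (h p hp hp').2.1

omit [IsProbabilityMeasure P] in
lemma IsMomentWeight.isGenOcc_sub (hw : IsMomentWeight P μ U w)
    (hU : Measurable (fun z : ℝ × Ω => U z.1 z.2)) (hQ : IsDominated w Q)
    (hQ' : IsDominated w Q') (h : IsGenOcc P μ U Q L) (h' : IsGenOcc P μ U Q' L') :
    IsGenOcc P μ U (Q - Q') (L - L') := by
  intro p hp hp'
  refine ((h p hp hp').sub hp (h' p hp hp')).congr (fun δ hδ => ?_) (ae_eq_refl _)
  rw [damp_sub, occ_sub hU (hw.integrable_damp hQ hδ) (hw.integrable_damp hQ' hδ)]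

omit [IsProbabilityMeasure P] [IsFiniteMeasure μ] in
lemma IsGenOcc.const_mul (h : IsGenOcc P μ U Q L) (c : ℂ) :
    IsGenOcc P μ U (fun ξ => c * Q ξ) (fun ω => c * L ω) := by
  intro p hp hp'
  simpa only [damp_const_mul, occ_const_mul] using (h p hp hp').const_mul c

omit [IsProbabilityMeasure P] [IsFiniteMeasure μ] in
lemma isGenOcc_zero (P : Measure Ω) (μ : Measure ℝ) (U : ℝ → Ω → Space d) :
    IsGenOcc P μ U (fun _ => 0) (fun _ => 0) := by
  intro p hp hp'
  have h0 : ∀ δ, occ μ U (damp δ fun _ : Space d => (0 : ℂ)) = fun _ => 0 := fun δ => by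
    ext ω; simp [occ, fourierSynth, damp]
  simp only [h0]
  exact ⟨fun _ _ => MemLp.zero, MemLp.zero, by simp⟩

omit [IsProbabilityMeasure P] in
lemma IsMomentWeight.isGenOcc_sum (hw : IsMomentWeight P μ U w)
    (hU : Measurable (fun z : ℝ × Ω => U z.1 z.2)) {ι : Type*} (s : Finset ι)
    {R : ι → Space d → ℂ} {K : ι → Ω → ℂ} (hR : ∀ i, IsDominated w (R i))
    (hK : ∀ i, IsGenOcc P μ U (R i) (K i)) :
    IsDominated w (fun ξ => ∑ i ∈ s, R i ξ) ∧
      IsGenOcc P μ U (fun ξ => ∑ i ∈ s, R i ξ) (fun ω => ∑ i ∈ s, K i ω) := by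
  classical
  induction s using Finset.induction_on with
  | empty =>
    simp only [Finset.sum_empty]
    exact ⟨⟨measurable_const, 0, le_rfl, by simp⟩, isGenOcc_zero P μ U⟩
  | insert a s ha ih =>
    have hR' := ih.1.const_mul (-1)
    have hK' := ih.2.const_mul (-1)
    -- Addition is expressed as subtraction of the multiple by `-1`, so that the rules for
    -- differences and scalars suffice.
    have e1 : (fun ξ => ∑ i ∈ insert a s, R i ξ) = R a - fun ξ => -1 * ∑ i ∈ s, R i ξ := by
      ext ξ; simp [Finset.sum_insert ha]
    have e2 : (fun ω => ∑ i ∈ insert a s, K i ω) = K a - fun ω => -1 * ∑ i ∈ s, K i ω := by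
      ext ω; simp [Finset.sum_insert ha]
    rw [e1, e2]
    exact ⟨(hR a).sub hR', hw.isGenOcc_sub hU (hR a) hR' (hK a) hK'⟩

lemma IsMomentWeight.isGenOcc_of_integrable (hw : IsMomentWeight P μ U w)
    (hU : Measurable (fun z : ℝ × Ω => U z.1 z.2)) (hQ : IsDominated w Q) (hi : Integrable Q) :
    IsGenOcc P μ U Q (occ μ U Q) := by
  intro p hp hp'
  have hpos : ∀ᶠ ε : ℝ in 𝓝[>] 0, 0 < ε := self_mem_nhdsWithin
  have hdamp : ∀ δ, 0 < δ → Integrable (damp δ Q) := fun δ hδ => hw.integrable_damp hQ hδ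
  refine ⟨fun δ hδ => memLp_occ hU (hdamp δ hδ) p, memLp_occ hU hi p, ?_⟩
  obtain ⟨hm, M, hM, hb⟩ := hQ
  have h1 : Tendsto (fun δ => eLpNorm (occ μ U (damp δ Q - Q)) p P) (𝓝[>] 0) (𝓝 0) := by
    refine hw.tendsto_eLpNorm_occ hU (M := M + M) (by positivity)
      (Eventually.of_forall fun q => (measurable_damp hm _).sub hm) ?_ ?_ ?_ hp'
    · filter_upwards [hpos] with q hq
      exact (hdamp _ hq).sub hi
    · filter_upwards [hpos] with q hq ξ
      refine (norm_sub_le _ _).trans ?_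
      rw [add_mul]
      exact add_le_add ((norm_damp_le hq.le ξ).trans (hb ξ)) (hb ξ)
    · intro ξ
      simpa using (tendsto_damp Q ξ).sub_const (Q ξ)
  refine h1.congr' ?_
  filter_upwards [hpos] with q hq
  rw [occ_sub hU (hdamp _ hq) hi]

/-- Dominated convergence for the generalized additive functionals. -/
lemma IsMomentWeight.tendsto_eLpNorm_isGenOcc (hw : IsMomentWeight P μ U w)
    (hU : Measurable (fun z : ℝ × Ω => U z.1 z.2)) {R : ℝ → Space d → ℂ} {K : ℝ → Ω → ℂ} {M : ℝ}
    (hM : 0 ≤ M) (hm : ∀ ε, 0 < ε → Measurable (R ε))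
    (hb : ∀ ε, 0 < ε → ∀ ξ, ‖R ε ξ‖ ≤ M * w ξ)
    (hl : ∀ ξ, Tendsto (fun ε => R ε ξ) (𝓝[>] 0) (𝓝 0))
    (hK : ∀ ε, 0 < ε → IsGenOcc P μ U (R ε) (K ε)) {p : ℝ≥0∞} (hp : 1 ≤ p) (hp' : p ≠ ⊤) :
    Tendsto (fun ε => eLpNorm (K ε) p P) (𝓝[>] 0) (𝓝 0) := by
  have hpos : ∀ᶠ ε : ℝ in 𝓝[>] 0, 0 < ε := self_mem_nhdsWithin
  -- The parameter and the damping tend to zero jointly. This gives, for each small `ε`, a bound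
  -- valid for all small dampings; it survives the limit in the damping, which is `K ε`.
  have h1 : Tendsto (fun q : ℝ × ℝ => eLpNorm (occ μ U (damp q.2 (R q.1))) p P)
      (𝓝[>] 0 ×ˢ 𝓝[>] 0) (𝓝 0) := by
    refine hw.tendsto_eLpNorm_occ hU hM ?_ ?_ ?_ ?_ hp'
    · filter_upwards [hpos.prod_mk hpos] with q hq
      exact measurable_damp (hm _ hq.1) _
    · filter_upwards [hpos.prod_mk hpos] with q hq
      exact hw.integrable_damp ⟨hm _ hq.1, M, hM, hb _ hq.1⟩ hq.2
    · filter_upwards [hpos.prod_mk hpos] with q hq ξ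
      exact (norm_damp_le hq.2.le ξ).trans (hb _ hq.1 ξ)
    · intro ξ
      rw [tendsto_zero_iff_norm_tendsto_zero]
      refine tendsto_of_tendsto_of_tendsto_of_le_of_le' tendsto_const_nhds
        ((tendsto_zero_iff_norm_tendsto_zero.mp (hl ξ)).comp tendsto_fst)
        (Eventually.of_forall fun _ => norm_nonneg _) ?_
      filter_upwards [hpos.prod_mk hpos] with q hq
      exact norm_damp_le hq.2.le ξ
  rw [ENNReal.tendsto_nhds_zero] at h1 ⊢
  intro c hc
  filter_upwards [(h1 c hc).curry, hpos] with ε hε hε0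
  exact (hK ε hε0 p hp hp').le_of_eventually_le hp hε

end GeneralizedOccupation

/-! ### The unimodular change to time increments and tail sums of frequencies -/

section Shear

variable {d : ℕ}

/-- The sum of the entries of a tuple from the index `j` on. -/
def tailSum {E : Type*} [AddCommMonoid E] {n : ℕ} (x : Fin n → E) (j : Fin n) : E :=
  ∑ i, if j ≤ i then x i else 0

lemma tailSum_zero {E : Type*} [AddCommMonoid E] {n : ℕ} (x : Fin (n + 1) → E) :
    tailSum x 0 = x 0 + ∑ i, x (Fin.succ i) := by
  simp [tailSum, Fin.sum_univ_succ]

lemma tailSum_succ {E : Type*} [AddCommMonoid E] {n : ℕ} (x : Fin (n + 1) → E) (j : Fin n) :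
    tailSum x j.succ = tailSum (fun i => x i.succ) j := by
  simp [tailSum, Fin.sum_univ_succ]

lemma measurable_tailSum {n : ℕ} (j : Fin n) :
    Measurable fun x : Fin n → Space d => tailSum x j := by
  unfold tailSum
  refine Finset.measurable_fun_sum _ fun i _ => ?_
  split_ifs
  · exact measurable_pi_apply i
  · exact measurable_const

lemma lintegral_pi_fin_succ {E : Type*} [MeasurableSpace E] (ν : Measure E) [SigmaFinite ν]
    {n : ℕ} {F : (Fin (n + 1) → E) → ℝ≥0∞} (hF : Measurable F) :
    ∫⁻ z, F z ∂(Measure.pi fun _ => ν) =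
      ∫⁻ z₀, ∫⁻ y, F (Fin.cons z₀ y) ∂(Measure.pi fun _ : Fin n => ν) ∂ν := by
  have h := (measurePreserving_piFinSuccAbove (fun _ : Fin (n + 1) => ν) 0).symm
  have hcons : ∀ (z₀ : E) (y : Fin n → E),
      (MeasurableEquiv.piFinSuccAbove (fun _ => E) 0).symm (z₀, y) = Fin.cons z₀ y :=
    fun z₀ y => Fin.insertNth_zero' z₀ y
  rw [← h.lintegral_comp hF, lintegral_prod]
  · simp only [hcons]
  · exact (hF.comp (MeasurableEquiv.measurable _)).aemeasurable

/-- The product of the functions of the increments of the times and of the tail sums of the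
frequencies. -/
def shearProd (K : ℝ × Space d → ℝ≥0∞) {n : ℕ} (c : ℝ) (z : Fin n → ℝ × Space d) : ℝ≥0∞ :=
  ∏ j, K ((z j).1 - (Fin.cons c fun i => (z i).1 : Fin (n + 1) → ℝ) j.castSucc,
    tailSum (fun i => (z i).2) j)

lemma measurable_shearProd {K : ℝ × Space d → ℝ≥0∞} (hK : Measurable K) (n : ℕ) :
    Measurable fun q : ℝ × (Fin n → ℝ × Space d) => shearProd K q.1 q.2 := by
  unfold shearProd
  refine Finset.measurable_fun_prod _ fun j _ => hK.comp (Measurable.prodMk ?_ ?_)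
  · have hz : ∀ i, Measurable fun q : ℝ × (Fin n → ℝ × Space d) => (q.2 i).1 := fun i =>
      ((measurable_pi_apply i).comp measurable_snd).fst
    refine (hz j).sub ?_
    refine Fin.cases ?_ (fun i => ?_) j.castSucc
    · simpa using measurable_fst
    · simpa using hz i
  · refine (measurable_tailSum j).comp (measurable_pi_lambda _ fun i => ?_)
    exact ((measurable_pi_apply i).comp measurable_snd).snd

lemma measurable_shearProd_const {K : ℝ × Space d → ℝ≥0∞} (hK : Measurable K) (n : ℕ) (c : ℝ) :
    Measurable fun z : Fin n → ℝ × Space d => shearProd K c z :=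
  (measurable_shearProd hK n).comp (measurable_const.prodMk measurable_id)

/-- The recursion behind the factorisation: the later variables enter the head factor only through a
translation of the first frequency, and the first time becomes the base point of the remaining
product. -/
lemma shearProd_cons (K : ℝ × Space d → ℝ≥0∞) {n : ℕ} (c : ℝ) (z₀ : ℝ × Space d)
    (y : Fin n → ℝ × Space d) :
    shearProd K c (Fin.cons z₀ y : Fin (n + 1) → ℝ × Space d) =
      K (z₀.1 - c, z₀.2 + ∑ i, (y i).2) * shearProd K z₀.1 y := by
  unfold shearProd
  rw [Fin.prod_univ_succ]
  congr 1
  · simp [tailSum_zero]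
  · refine Finset.prod_congr rfl fun j _ => ?_
    rw [tailSum_succ]
    congr 2
    simp only [Fin.cons_succ]
    congr 1
    rw [← Fin.succ_castSucc, Fin.cons_succ]
    refine Fin.cases ?_ (fun i => ?_) j.castSucc <;> simp

/-- The change of variables to the increments of the times and the tail sums of the frequencies
has the Jacobian one. -/
lemma lintegral_shearProd {K : ℝ × Space d → ℝ≥0∞} (hK : Measurable K) (n : ℕ) :
    ∀ c : ℝ, ∫⁻ z : Fin n → ℝ × Space d, shearProd K c z
        ∂(Measure.pi fun _ => (volume : Measure ℝ).prod volume) =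
      (∫⁻ s, ∫⁻ η, K (s, η)) ^ n := by
  induction n with
  | zero => intro c; simp [shearProd]
  | succ n ih =>
    intro c
    have hm := measurable_shearProd hK n
    rw [lintegral_pi_fin_succ _ (measurable_shearProd_const hK (n + 1) c)]
    simp only [shearProd_cons]
    have hy : Measurable fun y : Fin n → ℝ × Space d => ∑ i, (y i).2 :=
      Finset.measurable_fun_sum _ fun i _ => (measurable_pi_apply i).snd
    have hF : Measurable fun q : (ℝ × Space d) × (Fin n → ℝ × Space d) =>
        K (q.1.1 - c, q.1.2 + ∑ i, (q.2 i).2) * shearProd K q.1.1 q.2 := by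
      refine (hK.comp (Measurable.prodMk ?_ ?_)).mul ?_
      · exact (measurable_fst.comp measurable_fst).sub_const c
      · exact (measurable_snd.comp measurable_fst).add (hy.comp measurable_snd)
      · exact hm.comp ((measurable_fst.comp measurable_fst).prodMk measurable_snd)
    rw [lintegral_prod _ hF.lintegral_prod_right'.aemeasurable]
    have h1 : ∀ t : ℝ, ∫⁻ ξ : Space d, ∫⁻ y : Fin n → ℝ × Space d,
        K (t - c, ξ + ∑ i, (y i).2) * shearProd K t y
          ∂(Measure.pi fun _ => (volume : Measure ℝ).prod volume) =
        (∫⁻ η, K (t - c, η)) * (∫⁻ s, ∫⁻ η, K (s, η)) ^ n := by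
      intro t
      have hFt : Measurable (Function.uncurry fun (ξ : Space d) (y : Fin n → ℝ × Space d) =>
          K (t - c, ξ + ∑ i, (y i).2) * shearProd K t y) :=
        hF.comp (((measurable_const (a := t)).prodMk measurable_fst).prodMk measurable_snd)
      -- Integrating the first frequency before the others lets translation invariance remove the
      -- sum of the later frequencies; the induction hypothesis with base point `t` handles what is
      -- left.
      rw [lintegral_lintegral_swap hFt.aemeasurable, ← ih t, ← lintegral_const_mul]
      · refine lintegral_congr fun y => ?_
        rw [lintegral_mul_const]
        · rw [lintegral_add_right_eq_self (fun ξ => K (t - c, ξ))]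
        · exact hK.comp (measurable_const.prodMk (measurable_id.add_const _))
      · exact measurable_shearProd_const hK n t
    simp only [h1]
    have hk : Measurable fun t : ℝ => ∫⁻ η, K (t - c, η) :=
      (hK.lintegral_prod_right').comp (measurable_id.sub_const c)
    rw [lintegral_mul_const _ hk, lintegral_sub_right_eq_self (fun t => ∫⁻ η, K (t, η)), pow_succ, mul_comm]

end Shear

/-! ### Integrability of the one-step kernel -/

section GaussianKernel

variable {d : ℕ}

lemma integrable_exp_neg_mul_norm_sq {b : ℝ} (hb : 0 < b) :
    Integrable fun η : Space d => Real.exp (-b * ‖η‖ ^ 2) := by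
  have h := (GaussianFourier.integrable_cexp_neg_mul_sq_norm_add (V := Space d)
    (b := (b : ℂ)) (by simpa) 0 0).norm
  refine h.congr (ae_of_all _ fun η => ?_)
  simp only [Complex.norm_exp]
  congr 1
  simp [← Complex.ofReal_pow, ← Complex.ofReal_neg, ← Complex.ofReal_mul]

lemma integrable_one_add_norm_pow_mul_exp (q : ℕ) {c : ℝ} (hc : 0 < c) :
    Integrable fun η : Space d => (1 + ‖η‖) ^ q * Real.exp (-c * ‖η‖ ^ 2) := by
  refine ((integrable_exp_neg_mul_norm_sq (half_pos hc)).const_mul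
    (q.factorial * Real.exp (1 + 1 / (2 * c)))).mono' (by fun_prop) (ae_of_all _ fun η => ?_)
  rw [Real.norm_of_nonneg (by positivity)]
  have h1 : (1 + ‖η‖) ^ q ≤ q.factorial * Real.exp (1 + ‖η‖) := by
    have := Real.pow_div_factorial_le_exp (1 + ‖η‖) (by positivity) q
    rwa [div_le_iff₀' (by positivity)] at this
  calc (1 + ‖η‖) ^ q * Real.exp (-c * ‖η‖ ^ 2)
      ≤ q.factorial * Real.exp (1 + ‖η‖) * Real.exp (-c * ‖η‖ ^ 2) := by gcongr
    _ = q.factorial * Real.exp (1 + ‖η‖ + -c * ‖η‖ ^ 2) := by rw [mul_assoc, ← Real.exp_add]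
    _ ≤ q.factorial * Real.exp (1 + 1 / (2 * c) + -(c / 2) * ‖η‖ ^ 2) := by
      gcongr _ * Real.exp ?_
      -- Completing the square absorbs the exponential growth into half of the Gaussian exponent.
      have h2 : 0 ≤ c / 2 * (‖η‖ - 1 / c) ^ 2 := by positivity
      have h3 : c / 2 * (‖η‖ - 1 / c) ^ 2 = c / 2 * ‖η‖ ^ 2 - ‖η‖ + 1 / (2 * c) := by
        field_simp
        ring
      linarith
    _ = _ := by rw [Real.exp_add, mul_assoc]

lemma lintegral_comp_smul_space (f : Space d → ℝ≥0∞) (hf : Measurable f) {r : ℝ} (hr : 0 < r) :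
    ∫⁻ η, f η = ENNReal.ofReal (r ^ d) * ∫⁻ ζ, f (r • ζ) := by
  have h := Measure.map_addHaar_smul (volume : Measure (Space d)) hr.ne'
  have h2 : ∫⁻ ζ, f (r • ζ) = ∫⁻ η, f η ∂(Measure.map (r • ·) volume) :=
    (lintegral_map hf (measurable_const_smul r)).symm
  rw [h2, h, lintegral_smul_measure, smul_eq_mul, ← mul_assoc, finrank_euclideanSpace_fin,
    ← ENNReal.ofReal_mul (by positivity), abs_of_pos (by positivity),
    mul_inv_cancel₀ (by positivity), ENNReal.ofReal_one, one_mul]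

/-- The integrand for one time increment `s` and one tail sum `η`. -/
def gaussKernel (T c H : ℝ) (q : ℕ) (z : ℝ × Space d) : ℝ≥0∞ :=
  (Set.Ioc 0 T).indicator (fun s => ENNReal.ofReal
    ((1 + ‖z.2‖) ^ q * Real.exp (-c * (s ^ (2 * H) * ‖z.2‖ ^ 2)))) z.1

lemma measurable_gaussKernel (T c H : ℝ) (q : ℕ) :
    Measurable (gaussKernel (d := d) T c H q) := by
  have h : gaussKernel (d := d) T c H q = (Prod.fst ⁻¹' Set.Ioc 0 T).indicator
      fun z => ENNReal.ofReal
        ((1 + ‖z.2‖) ^ q * Real.exp (-c * (z.1 ^ (2 * H) * ‖z.2‖ ^ 2))) := by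
    ext z
    simp [gaussKernel, Set.indicator]
  rw [h]
  exact Measurable.indicator (by fun_prop) (measurable_fst measurableSet_Ioc)

/-- The substitution `η = s^{-H} ζ` makes the Gaussian factor free of `s` and costs `s^{-Hd}` from
the volume and at most a constant times `s^{-Hq}` from the weight. The power `s^{-H(q+d)}` is
integrable at zero exactly when `H(q + d) < 1`. -/
lemma lintegral_gaussKernel_ne_top {T c H : ℝ} (hc : 0 < c) (hH : 0 < H) {q : ℕ}
    (hq : H * (q + d) < 1) :
    ∫⁻ s, ∫⁻ η : Space d, gaussKernel T c H q (s, η) ≠ ⊤ := by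
  set A : ℝ≥0∞ := ∫⁻ ζ : Space d, ENNReal.ofReal ((1 + ‖ζ‖) ^ q * Real.exp (-c * ‖ζ‖ ^ 2))
    with hA
  have hA' : A ≠ ⊤ := (integrable_one_add_norm_pow_mul_exp (d := d) q hc).lintegral_lt_top.ne
  have hinner : ∀ s, ∫⁻ η : Space d, gaussKernel T c H q (s, η) ≤
      (Set.Ioc 0 T).indicator
        (fun s => ENNReal.ofReal (s ^ (-(H * (q + d)))) * (ENNReal.ofReal ((1 + T ^ H) ^ q) * A))
        s := by
    intro s
    by_cases hs : s ∈ Set.Ioc 0 T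
    swap
    · simp [gaussKernel, hs]
    simp only [gaussKernel, Set.indicator_of_mem hs]
    have hs0 : 0 < s := hs.1
    have hr : 0 < s ^ (-H) := Real.rpow_pos_of_pos hs0 _
    rw [lintegral_comp_smul_space _ (by fun_prop) hr]
    have hb : ∀ ζ : Space d, ENNReal.ofReal ((1 + ‖s ^ (-H) • ζ‖) ^ q *
        Real.exp (-c * (s ^ (2 * H) * ‖s ^ (-H) • ζ‖ ^ 2))) ≤
        ENNReal.ofReal ((s ^ (-H)) ^ q * (1 + T ^ H) ^ q) *
          ENNReal.ofReal ((1 + ‖ζ‖) ^ q * Real.exp (-c * ‖ζ‖ ^ 2)) := by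
      intro ζ
      have hT : 0 < T := hs0.trans_le hs.2
      have hTH : 0 < T ^ H := Real.rpow_pos_of_pos hT _
      rw [← ENNReal.ofReal_mul (by positivity)]
      refine ENNReal.ofReal_le_ofReal ?_
      rw [norm_smul, Real.norm_of_nonneg hr.le]
      have e1 : s ^ (2 * H) * (s ^ (-H) * ‖ζ‖) ^ 2 = ‖ζ‖ ^ 2 := by
        rw [mul_pow, ← mul_assoc, ← Real.rpow_natCast (s ^ (-H)) 2, ← Real.rpow_mul hs0.le,
          ← Real.rpow_add hs0]
        have : 2 * H + -H * ((2 : ℕ) : ℝ) = 0 := by push_cast; ring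
        rw [this, Real.rpow_zero, one_mul]
      -- The factor `s^{-H}` is also extracted from the summand `1`, which `s ≤ T` permits at the
      -- price of `T^H`.
      have e2 : 1 + s ^ (-H) * ‖ζ‖ ≤ s ^ (-H) * (1 + T ^ H) * (1 + ‖ζ‖) := by
        have h1 : 1 ≤ s ^ (-H) * T ^ H := by
          calc (1 : ℝ) = s ^ (-H) * s ^ H := by rw [← Real.rpow_add hs0]; simp
            _ ≤ s ^ (-H) * T ^ H := by gcongr; exact hs.2
        have h2 : 0 ≤ s ^ (-H) * T ^ H * ‖ζ‖ := by positivity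
        nlinarith
      rw [e1, ← mul_pow, ← mul_assoc, ← mul_pow]
      gcongr
    refine (mul_le_mul_right (lintegral_mono hb) _).trans_eq ?_
    rw [lintegral_const_mul _ (by fun_prop), ← hA, ENNReal.ofReal_mul (by positivity),
      ← mul_assoc, ← mul_assoc, ← mul_assoc, ← ENNReal.ofReal_mul (by positivity), ← pow_add,
      ← Real.rpow_natCast, ← Real.rpow_mul hs0.le]
    congr 4
    push_cast
    ring
  refine ne_top_of_le_ne_top ?_ (lintegral_mono hinner)
  rw [lintegral_indicator measurableSet_Ioc, lintegral_mul_const _ (by fun_prop)]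
  refine ENNReal.mul_ne_top ?_ (ENNReal.mul_ne_top ENNReal.ofReal_ne_top hA')
  by_cases hT : 0 ≤ T
  · have h := intervalIntegral.intervalIntegrable_rpow' (a := 0) (b := T)
      (r := -(H * (q + d))) (by linarith)
    rw [intervalIntegrable_iff_integrableOn_Ioc_of_le hT] at h
    exact h.lintegral_lt_top.ne
  · simp [Set.Ioc_eq_empty_of_le (le_of_not_ge hT)]

end GaussianKernel

/-! ### Gaussian decay of the joint characteristic function -/

section CharacteristicFunction

variable {Ω : Type*} [MeasurableSpace Ω] {P : Measure Ω} {d : ℕ} {H : ℝ}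
  {X : ℝ≥0 → Ω → Space d}

/-- The mean contributes only a phase, so no centring of the process is needed. -/
lemma norm_integral_cexp_of_hasGaussianLaw {Z : Ω → ℝ} (hZ : HasGaussianLaw Z P) :
    ‖∫ ω, Complex.exp (Complex.I * ((Z ω : ℝ) : ℂ)) ∂P‖ = Real.exp (-(Var[Z; P] / 2)) := by
  have h1 : ∫ ω, Complex.exp (Complex.I * ((Z ω : ℝ) : ℂ)) ∂P = charFun (P.map Z) 1 := by
    rw [charFun_apply_real, integral_map hZ.aemeasurable (by fun_prop)]
    congr 1 with ω
    congr 1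
    push_cast
    ring
  rw [h1, hZ.map_eq_gaussianReal, charFun_gaussianReal, Complex.norm_exp,
    Real.coe_toNNReal _ (variance_nonneg _ _)]
  congr 1
  have : ((P[Z] : ℝ) : ℂ) * Complex.I - ((Var[Z; P] : ℝ) : ℂ) / 2 =
      ((-(Var[Z; P] / 2) : ℝ) : ℂ) + ((P[Z] : ℝ) : ℂ) * Complex.I := by push_cast; ring
  simp [this]

/-- Summation by parts. -/
lemma sum_mul_eq_sum_tailSum_mul {n : ℕ} : ∀ (b : Fin n → ℝ) (v : Fin (n + 1) → ℝ),
    ∑ j, b j * v j.succ =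
      ∑ j, tailSum b j * (v j.succ - v j.castSucc) + (∑ j, b j) * v 0 := by
  induction n with
  | zero => intro b v; simp
  | succ n ih =>
    intro b v
    rw [Fin.sum_univ_succ, Fin.sum_univ_succ (f := fun j => tailSum b j * _),
      ih (fun j => b j.succ) (fun j => v j.succ), tailSum_zero, Fin.sum_univ_succ (f := b)]
    simp only [tailSum_succ, Fin.castSucc_zero, ← Fin.succ_castSucc, Fin.succ_zero_eq_one]
    ring

/-- Time zero is fixed by the scaling, so self-similarity with the factor `2` gives `Var = 2^{2H}
Var`, which forces the variance to vanish. -/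
lemma MemG.variance_zero [IsProbabilityMeasure P] (hX : MemG H X P) (hH : 0 < H) (l : Fin d) :
    Var[fun ω => X 0 ω l; P] = 0 := by
  have h1 := (hX.selfSimilar l 2 (by norm_num)).comp
    (u := fun path : ℝ≥0 → ℝ => path 0) (measurable_pi_apply 0)
  have h2 := h1.variance_eq
  simp only [Function.comp_def, mul_zero] at h2
  rw [variance_const_mul] at h2
  have h3 : (1 : ℝ) < (((2 : ℝ≥0) : ℝ) ^ H) ^ 2 :=
    one_lt_pow₀ (Real.one_lt_rpow (by norm_num) hH) (by norm_num)
  nlinarith [variance_nonneg (fun ω => X 0 ω l) P]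

/-- Local non-determinism in terms of linear combinations of the values. -/
lemma MemG.variance_sum [IsProbabilityMeasure P] (hX : MemG H X P) (hH : 0 < H) {n : ℕ}
    {κ : ℝ} (l : Fin d) (b : Fin n → ℝ) (t : Fin n → ℝ≥0)
    (hκ : ∀ (a : Fin n → ℝ) (t : Fin (n + 1) → ℝ≥0), t 0 = 0 → StrictMono t →
      κ * ∑ j : Fin n, |a j| ^ 2 * ((t j.succ : ℝ) - (t j.castSucc : ℝ)) ^ (2 * H) ≤
        Var[fun ω => ∑ j : Fin n, a j * (X (t j.succ) ω l - X (t j.castSucc) ω l); P])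
    (ht : StrictMono (Fin.cons 0 t : Fin (n + 1) → ℝ≥0)) :
    κ * ∑ j : Fin n, |tailSum b j| ^ 2 *
        ((t j : ℝ) - ((Fin.cons 0 t : Fin (n + 1) → ℝ≥0) j.castSucc : ℝ)) ^ (2 * H) ≤
      Var[fun ω => ∑ j, b j * X (t j) ω l; P] := by
  obtain ⟨τ, hτ⟩ : ∃ τ : Fin (n + 1) → ℝ≥0, τ = Fin.cons 0 t := ⟨_, rfl⟩
  -- Since `X_0` is almost surely constant, the boundary term of the summation by parts does not
  -- affect the variance.
  have h0 : (fun ω => X 0 ω l) =ᵐ[P] fun _ => P[fun ω => X 0 ω l] := by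
    have hm : MemLp (fun ω => X 0 ω l) 2 P := ((hX.gaussian l).hasGaussianLaw_eval 0).memLp_two
    exact ae_eq_integral_of_variance_eq_zero hm (hX.variance_zero hH l)
  have h1 : (fun ω => ∑ j, b j * X (t j) ω l) =ᵐ[P]
      fun ω => ∑ j, tailSum b j * (X (τ j.succ) ω l - X (τ j.castSucc) ω l) +
        (∑ j, b j) * P[fun ω => X 0 ω l] := by
    filter_upwards [h0] with ω hω
    have := sum_mul_eq_sum_tailSum_mul b (fun j => X (τ j) ω l)
    simp only [hτ, Fin.cons_succ, Fin.cons_zero] at this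
    rw [this, hω]
    simp only [hτ, Fin.cons_succ]
  have hmeas : AEStronglyMeasurable (fun ω =>
      ∑ j, tailSum b j * (X (τ j.succ) ω l - X (τ j.castSucc) ω l)) P := by
    have : ∀ s, Measurable fun ω => X s ω l := fun s => by
      have := hX.measurable s
      fun_prop
    exact (Finset.measurable_fun_sum _ fun j _ =>
      ((this _).sub (this _)).const_mul _).aestronglyMeasurable
  rw [variance_congr h1, variance_add_const hmeas]
  have h2 := hκ (tailSum b) τ (by simp [hτ]) (hτ ▸ ht)
  simpa only [hτ, Fin.cons_succ] using h2

lemma MemG.norm_integral_cexp_coord (hX : MemG H X P) {n : ℕ}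
    (l : Fin d) (b : Fin n → ℝ) (t : Fin n → ℝ≥0) :
    ‖∫ ω, Complex.exp (Complex.I * ((∑ j, b j * X (t j) ω l : ℝ) : ℂ)) ∂P‖ =
      Real.exp (-(Var[fun ω => ∑ j, b j * X (t j) ω l; P] / 2)) := by
  refine norm_integral_cexp_of_hasGaussianLaw ?_
  exact (((hX.gaussian l).comp_right t).smul b).hasGaussianLaw_fun_sum (I := Finset.univ)

/-- Independence of the components reduces the estimate to one-dimensional Gaussian laws. -/
lemma MemG.integral_cexp_eq_prod (hX : MemG H X P) {n : ℕ}
    (ξ : Fin n → Space d) (t : Fin n → ℝ≥0) :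
    ∫ ω, Complex.exp (Complex.I * ((∑ j, inner ℝ (ξ j) (X (t j) ω) : ℝ) : ℂ)) ∂P =
      ∏ l, ∫ ω, Complex.exp (Complex.I * ((∑ j, ξ j l * X (t j) ω l : ℝ) : ℂ)) ∂P := by
  have hm : ∀ l : Fin d, AEMeasurable (fun ω (s : ℝ≥0) => X s ω l) P := by
    intro l
    refine (measurable_pi_lambda _ fun s => ?_).aemeasurable
    have := hX.measurable s
    fun_prop
  have h := hX.indep.integral_fun_prod_comp (𝕜 := ℂ)
    (f := fun l (path : ℝ≥0 → ℝ) =>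
      Complex.exp (Complex.I * ((∑ j, ξ j l * path (t j) : ℝ) : ℂ))) hm
    (fun l => by
      refine Measurable.aestronglyMeasurable ?_
      fun_prop)
  rw [← h]
  congr 1 with ω
  rw [← Complex.exp_sum, ← Finset.mul_sum, ← Complex.ofReal_sum, Finset.sum_comm]
  congr 4 with j
  simp [PiLp.inner_apply, mul_comm]

/-- The joint characteristic function at ordered times decays like a Gaussian function of the tail
sums of the frequencies. -/
lemma MemG.exists_norm_integral_cexp_le [IsProbabilityMeasure P] (hX : MemG H X P) (hH : 0 < H)
    {n : ℕ} (hn : 1 ≤ n) :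
    ∃ c : ℝ, 0 < c ∧ ∀ (ξ : Fin n → Space d) (t : Fin n → ℝ≥0),
      StrictMono (Fin.cons 0 t : Fin (n + 1) → ℝ≥0) →
      ‖∫ ω, Complex.exp (Complex.I * ((∑ j, inner ℝ (ξ j) (X (t j) ω) : ℝ) : ℂ)) ∂P‖ ≤
        ∏ j, Real.exp (-c *
          (((t j : ℝ) - ((Fin.cons 0 t : Fin (n + 1) → ℝ≥0) j.castSucc : ℝ)) ^ (2 * H) *
            ‖tailSum ξ j‖ ^ 2)) := by
  obtain ⟨κ, hκ0, hκ⟩ := hX.localNondeterminism n hn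
  -- The half comes from the exponent `-Var / 2` of a Gaussian characteristic function.
  refine ⟨κ / 2, by positivity, fun ξ t ht => ?_⟩
  rw [hX.integral_cexp_eq_prod, norm_prod]
  simp only [fun l => hX.norm_integral_cexp_coord l (fun j => ξ j l) t]
  rw [← Real.exp_sum, ← Real.exp_sum]
  refine Real.exp_le_exp.mpr ?_
  have htail : ∀ j, ‖tailSum ξ j‖ ^ 2 = ∑ l, |tailSum (fun j => ξ j l) j| ^ 2 := by
    intro j
    rw [EuclideanSpace.norm_sq_eq]
    refine Finset.sum_congr rfl fun l _ => ?_
    rw [Real.norm_eq_abs]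
    congr 2
    simp only [tailSum, WithLp.ofLp_sum, Finset.sum_apply]
    refine Finset.sum_congr rfl fun i _ => ?_
    split_ifs <;> simp
  have h1 : ∀ l : Fin d, -(Var[fun ω => ∑ j, ξ j l * X (t j) ω l; P] / 2) ≤
      -(κ / 2) * ∑ j : Fin n, |tailSum (fun j => ξ j l) j| ^ 2 *
        ((t j : ℝ) - ((Fin.cons 0 t : Fin (n + 1) → ℝ≥0) j.castSucc : ℝ)) ^ (2 * H) := by
    intro l
    have := hX.variance_sum hH l (fun j => ξ j l) t (hκ l) ht
    linarith
  refine (Finset.sum_le_sum fun l _ => h1 l).trans_eq ?_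
  rw [← Finset.mul_sum, ← Finset.mul_sum, Finset.sum_comm]
  congr 1
  refine Finset.sum_congr rfl fun j _ => ?_
  rw [htail, ← Finset.sum_mul, mul_comm]

end CharacteristicFunction

/-! ### Polynomial moment weights from local non-determinism -/

section MomentWeight

variable {Ω : Type*} [MeasurableSpace Ω] {P : Measure Ω} {d : ℕ} {H : ℝ}
  {X : ℝ≥0 → Ω → Space d}

/-- Each `x_j` is the difference of two consecutive tail sums, whence `1 + |x_j| ≤ (1 + |η_j|)(1 +
|η_{j+1}|)`. Every tail sum is used at most twice, which explains the exponent `2q`; the additional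
factor with the full sum is what lets the induction close. -/
lemma prod_one_add_norm_pow_le_prod_tailSum (q : ℕ) {n : ℕ} : ∀ x : Fin n → Space d,
    (∏ j, (1 + ‖x j‖) ^ q) * (1 + ‖∑ j, x j‖) ^ q ≤ ∏ j, (1 + ‖tailSum x j‖) ^ (2 * q) := by
  induction n with
  | zero => intro x; simp
  | succ n ih =>
    intro x
    set S := ∑ j : Fin n, x j.succ with hS
    rw [Fin.prod_univ_succ, Fin.prod_univ_succ (f := fun j => (1 + ‖tailSum x j‖) ^ (2 * q)),
      Fin.sum_univ_succ, tailSum_zero, ← hS]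
    simp only [tailSum_succ]
    have h0 : 1 + ‖x 0‖ ≤ (1 + ‖x 0 + S‖) * (1 + ‖S‖) := by
      have h1 : ‖x 0‖ ≤ ‖x 0 + S‖ + ‖S‖ := by
        simpa using norm_sub_le (x 0 + S) S
      have h2 : 0 ≤ ‖x 0 + S‖ * ‖S‖ := by positivity
      nlinarith
    calc (1 + ‖x 0‖) ^ q * (∏ j : Fin n, (1 + ‖x j.succ‖) ^ q) * (1 + ‖x 0 + S‖) ^ q
        ≤ ((1 + ‖x 0 + S‖) * (1 + ‖S‖)) ^ q * (∏ j : Fin n, (1 + ‖x j.succ‖) ^ q) *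
            (1 + ‖x 0 + S‖) ^ q := by gcongr
      _ = (1 + ‖x 0 + S‖) ^ (2 * q) *
            ((∏ j : Fin n, (1 + ‖x j.succ‖) ^ q) * (1 + ‖S‖) ^ q) := by
          rw [mul_pow, two_mul, pow_add]; ring
      _ ≤ _ := by
          gcongr
          exact ih fun j => x j.succ

lemma prod_one_add_norm_pow_le (q : ℕ) {n : ℕ} (x : Fin n → Space d) :
    ∏ j, (1 + ‖x j‖) ^ q ≤ ∏ j, (1 + ‖tailSum x j‖) ^ (2 * q) :=
  (le_mul_of_one_le_right (by positivity)
    (one_le_pow₀ (le_add_of_nonneg_right (norm_nonneg _)))).trans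
    (prod_one_add_norm_pow_le_prod_tailSum q x)

/-- A coincidence of two times is the kernel of a nonzero linear functional, a proper subspace and
hence a null set. -/
lemma ae_injective_fst (n : ℕ) :
    ∀ᵐ z : Fin n → ℝ × Space d ∂(Measure.pi fun _ => (volume : Measure ℝ).prod volume),
      Function.Injective fun j => (z j).1 := by
  have h : ∀ i j : Fin n, i ≠ j → ∀ᵐ z : Fin n → ℝ × Space d, (z i).1 ≠ (z j).1 := by
    intro i j hij
    let f : (Fin n → ℝ × Space d) →ₗ[ℝ] ℝ :=
      (LinearMap.fst ℝ ℝ (Space d)).comp (LinearMap.proj i) -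
        (LinearMap.fst ℝ ℝ (Space d)).comp (LinearMap.proj j)
    have hf : LinearMap.ker f ≠ ⊤ := by
      intro hker
      have h1 : f (Pi.single i ((1 : ℝ), (0 : Space d))) = 0 := by
        rw [← LinearMap.mem_ker, hker]; trivial
      simp [f, hij.symm] at h1
    have hprod : (volume : Measure (ℝ × Space d)).IsAddHaarMeasure :=
      inferInstanceAs ((volume : Measure ℝ).prod (volume : Measure (Space d))).IsAddHaarMeasure
    have hadd : MeasurableAdd (ℝ × Space d) := inferInstance
    have hpi : (volume : Measure (Fin n → ℝ × Space d)).IsAddHaarMeasure :=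
      inferInstanceAs (Measure.pi fun _ : Fin n =>
        (volume : Measure (ℝ × Space d))).IsAddHaarMeasure
    have h2 := Measure.addHaar_submodule (volume : Measure (Fin n → ℝ × Space d)) _ hf
    rw [ae_iff]
    refine measure_mono_null (fun z hz => ?_) h2
    simp only [ne_eq, not_not, Set.mem_ofPred_eq] at hz
    simp [f, hz]
  have h' : ∀ᵐ z : Fin n → ℝ × Space d, ∀ i j : Fin n, i ≠ j → (z i).1 ≠ (z j).1 := by
    simp only [ae_all_iff]
    exact fun i j hij => h i j hij
  filter_upwards [h'] with z hz i j hij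
  by_contra hne
  exact hz i j hne hij

lemma lintegral_comp_perm {E : Type*} [MeasurableSpace E] (ν : Measure E) [SigmaFinite ν] {n : ℕ}
    (σ : Equiv.Perm (Fin n)) {G : (Fin n → E) → ℝ≥0∞} (hG : Measurable G) :
    ∫⁻ z, G (z ∘ σ) ∂(Measure.pi fun _ => ν) = ∫⁻ z, G z ∂(Measure.pi fun _ => ν) := by
  have h := measurePreserving_piCongrLeft (fun _ : Fin n => ν) σ.symm
  rw [← h.lintegral_comp hG]
  refine lintegral_congr fun z => ?_
  congr 1
  ext i
  have := Equiv.piCongrLeft_apply_apply (fun _ : Fin n => E) σ.symm z (σ i)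
  simp only [Equiv.symm_apply_apply] at this
  exact this.symm

lemma pi_restrict_eq (n : ℕ) (s : Set ℝ) :
    (Measure.pi fun _ : Fin n => (volume.restrict s).prod (volume : Measure (Space d))) =
      (Measure.pi fun _ : Fin n => (volume : Measure ℝ).prod (volume : Measure (Space d))).restrict
        (Set.univ.pi fun _ => s ×ˢ Set.univ) := by
  rw [Measure.restrict_pi_pi]
  congr 1
  ext1 i
  rw [← Measure.prod_restrict, Measure.restrict_univ]

lemma jointChar_comp_perm (U : ℝ → Ω → Space d) {n : ℕ} (σ : Equiv.Perm (Fin n))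
    (z : Fin n → ℝ × Space d) : jointChar P U (z ∘ σ) = jointChar P U z := by
  unfold jointChar
  congr 1 with ω
  congr 3
  exact Equiv.sum_comp σ fun j => inner ℝ (z j).2 (U (z j).1 ω)

/-- The shift by `x` is only a phase, so all the estimates are independent of `x`. -/
lemma enorm_jointChar_shift {U : ℝ → Ω → Space d} {x : Space d} {n : ℕ}
    {z : Fin n → ℝ × Space d}
    (hz : ∀ j, ∀ᵐ ω ∂P, U (z j).1 ω = X (z j).1.toNNReal ω + x) :
    ‖jointChar P U z‖ₑ = ‖∫ ω, Complex.exp (Complex.I *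
      ((∑ j, inner ℝ (z j).2 (X (z j).1.toNNReal ω) : ℝ) : ℂ)) ∂P‖ₑ := by
  have h1 : jointChar P U z = ∫ ω, Complex.exp (Complex.I * ((∑ j, inner ℝ (z j).2 x : ℝ) : ℂ)) *
      Complex.exp (Complex.I *
        ((∑ j, inner ℝ (z j).2 (X (z j).1.toNNReal ω) : ℝ) : ℂ)) ∂P := by
    refine integral_congr_ae ?_
    filter_upwards [ae_all_iff.mpr hz] with ω hω
    rw [← Complex.exp_add, ← mul_add, ← Complex.ofReal_add, ← Finset.sum_add_distrib]
    congr 3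
    refine Finset.sum_congr rfl fun j _ => ?_
    rw [hω j, inner_add_right, add_comm]
  rw [h1, integral_const_mul, enorm_mul, ← ofReal_norm (Complex.exp _), norm_cexp_I_mul_ofReal,
    ENNReal.ofReal_one, one_mul]

lemma le_shearProd_of_strictMono [IsProbabilityMeasure P] {T c : ℝ} {q n : ℕ}
    {U : ℝ → Ω → Space d} {x : Space d}
    (hc : ∀ (ξ : Fin n → Space d) (t : Fin n → ℝ≥0),
      StrictMono (Fin.cons 0 t : Fin (n + 1) → ℝ≥0) →
      ‖∫ ω, Complex.exp (Complex.I * ((∑ j, inner ℝ (ξ j) (X (t j) ω) : ℝ) : ℂ)) ∂P‖ ≤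
        ∏ j, Real.exp (-c *
          (((t j : ℝ) - ((Fin.cons 0 t : Fin (n + 1) → ℝ≥0) j.castSucc : ℝ)) ^ (2 * H) *
            ‖tailSum ξ j‖ ^ 2)))
    {z : Fin n → ℝ × Space d} (hz : ∀ j, (z j).1 ∈ Set.Ioc 0 T)
    (hU : ∀ j, ∀ᵐ ω ∂P, U (z j).1 ω = X (z j).1.toNNReal ω + x)
    (hmono : StrictMono fun j => (z j).1) :
    (∏ j, ENNReal.ofReal ((1 + ‖(z j).2‖) ^ q)) * ‖jointChar P U z‖ₑ ≤
      shearProd (gaussKernel T c H (2 * q)) 0 z := by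
  have hpos : ∀ j, 0 ≤ (z j).1 := fun j => (hz j).1.le
  set t : Fin n → ℝ≥0 := fun j => (z j).1.toNNReal with ht
  have htc : ∀ j, ((t j : ℝ≥0) : ℝ) = (z j).1 := fun j => Real.coe_toNNReal _ (hpos j)
  have hcons : ∀ i, (((Fin.cons 0 t : Fin (n + 1) → ℝ≥0) i : ℝ≥0) : ℝ) =
      (Fin.cons 0 fun i => (z i).1 : Fin (n + 1) → ℝ) i := by
    intro i
    refine Fin.cases ?_ (fun i => ?_) i
    · simp
    · simp [htc]
  have htm : StrictMono (Fin.cons 0 t : Fin (n + 1) → ℝ≥0) := by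
    intro i j
    rw [← NNReal.coe_lt_coe, hcons, hcons]
    refine Fin.cases ?_ (fun i => ?_) i <;> refine Fin.cases ?_ (fun j => ?_) j
    · simp
    · intro _; simpa using (hz j).1
    · intro h; simp at h
    · intro h; simpa using hmono (Fin.succ_lt_succ_iff.mp h)
  -- The increments of ordered times in `(0, T]`, started from zero, lie again in `(0, T]`; so the
  -- indicator in `gaussKernel` equals one at each of them.
  have hinc : ∀ j, (z j).1 - (Fin.cons 0 fun i => (z i).1 : Fin (n + 1) → ℝ) j.castSucc ∈
      Set.Ioc 0 T := by
    intro j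
    have h1 := htm (Fin.castSucc_lt_succ (i := j))
    rw [← NNReal.coe_lt_coe, hcons, hcons, Fin.cons_succ] at h1
    have h2 : 0 ≤ (Fin.cons 0 fun i => (z i).1 : Fin (n + 1) → ℝ) j.castSucc := by
      rw [← hcons]; positivity
    exact ⟨by linarith, by linarith [(hz j).2]⟩
  rw [enorm_jointChar_shift hU, ← ENNReal.ofReal_prod_of_nonneg fun _ _ => by positivity,
    ← ofReal_norm, ← ENNReal.ofReal_mul (by positivity)]
  have h3 : shearProd (gaussKernel T c H (2 * q)) 0 z = ENNReal.ofReal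
      (∏ j, ((1 + ‖tailSum (fun i => (z i).2) j‖) ^ (2 * q) * Real.exp (-c *
        (((z j).1 - (Fin.cons 0 fun i => (z i).1 : Fin (n + 1) → ℝ) j.castSucc) ^ (2 * H) *
          ‖tailSum (fun i => (z i).2) j‖ ^ 2)))) := by
    rw [ENNReal.ofReal_prod_of_nonneg fun _ _ => by positivity]
    refine Finset.prod_congr rfl fun j _ => ?_
    simp only [gaussKernel, Set.indicator_of_mem (hinc j)]
  rw [h3, Finset.prod_mul_distrib]
  refine ENNReal.ofReal_le_ofReal (mul_le_mul (prod_one_add_norm_pow_le q fun i => (z i).2) ?_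
    (norm_nonneg _) (by positivity))
  have h4 := hc (fun j => (z j).2) t htm
  simpa only [hcons, htc] using h4

/-- Reduction to ordered times: a symmetric integrand is unchanged by sorting, ties are null, and
the bound at the sorted point is one term of the sum over all permutations. The predicate `A`
carries properties that hold only at almost every time. -/
lemma lintegral_pi_restrict_le_sum_perm {T : ℝ} {n : ℕ} {F G : (Fin n → ℝ × Space d) → ℝ≥0∞}
    (hG : Measurable G) {A : ℝ → Prop}
    (hA : ∀ᵐ t ∂(volume.restrict (Set.Ioc 0 T)), A t)
    (hF : ∀ (z : Fin n → ℝ × Space d) (σ : Equiv.Perm (Fin n)), F (z ∘ σ) = F z)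
    (hFG : ∀ z : Fin n → ℝ × Space d, (∀ j, (z j).1 ∈ Set.Ioc 0 T ∧ A (z j).1) →
      (StrictMono fun j => (z j).1) → F z ≤ G z) :
    ∫⁻ z, F z ∂(Measure.pi fun _ : Fin n =>
        (volume.restrict (Set.Ioc 0 T)).prod (volume : Measure (Space d))) ≤
      ∑ _σ : Equiv.Perm (Fin n), ∫⁻ z, G z ∂(Measure.pi fun _ : Fin n =>
        (volume : Measure ℝ).prod (volume : Measure (Space d))) := by
  have hev : ∀ᵐ z : Fin n → ℝ × Space d
      ∂(Measure.pi fun _ => (volume.restrict (Set.Ioc 0 T)).prod volume),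
      ∀ j, (z j).1 ∈ Set.Ioc 0 T ∧ A (z j).1 := by
    rw [ae_all_iff]
    intro j
    exact (Measure.quasiMeasurePreserving_fst.comp
      (Measure.quasiMeasurePreserving_eval (fun _ : Fin n =>
        (volume.restrict (Set.Ioc (0 : ℝ) T)).prod (volume : Measure (Space d))) j)).ae
      ((ae_restrict_mem measurableSet_Ioc).and hA)
  have hinj : ∀ᵐ z : Fin n → ℝ × Space d
      ∂(Measure.pi fun _ => (volume.restrict (Set.Ioc 0 T)).prod volume),
      Function.Injective fun j => (z j).1 := by
    rw [pi_restrict_eq]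
    exact ae_restrict_of_ae (ae_injective_fst n)
  have hGσ : ∀ σ : Equiv.Perm (Fin n), Measurable fun z : Fin n → ℝ × Space d => G (z ∘ σ) :=
    fun σ => hG.comp (measurable_pi_lambda _ fun i => measurable_pi_apply (σ i))
  calc ∫⁻ z, F z ∂(Measure.pi fun _ : Fin n =>
        (volume.restrict (Set.Ioc 0 T)).prod (volume : Measure (Space d)))
      ≤ ∫⁻ z, ∑ σ : Equiv.Perm (Fin n), G (z ∘ σ) ∂(Measure.pi fun _ : Fin n =>
        (volume.restrict (Set.Ioc 0 T)).prod (volume : Measure (Space d))) := by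
        refine lintegral_mono_ae ?_
        filter_upwards [hev, hinj] with z hz hzi
        obtain ⟨σ, hσ⟩ : ∃ σ, σ = Tuple.sort fun j => (z j).1 := ⟨_, rfl⟩
        have hmono : StrictMono fun j => ((z ∘ σ) j).1 := by
          rw [hσ]
          exact (Tuple.monotone_sort fun j => (z j).1).strictMono_of_injective
            (hzi.comp (Equiv.injective _))
        rw [← hF z σ]
        exact (hFG (z ∘ σ) (fun j => hz (σ j)) hmono).trans
          (Finset.single_le_sum (f := fun σ : Equiv.Perm (Fin n) => G (z ∘ σ))
            (fun _ _ => zero_le) (Finset.mem_univ σ))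
    _ ≤ ∫⁻ z, ∑ σ : Equiv.Perm (Fin n), G (z ∘ σ) ∂(Measure.pi fun _ : Fin n =>
        (volume : Measure ℝ).prod (volume : Measure (Space d))) := by
        rw [pi_restrict_eq]
        exact setLIntegral_le_lintegral _ _
    _ = _ := by
        rw [lintegral_finsetSum _ fun σ _ => hGσ σ]
        exact Finset.sum_congr rfl fun σ _ => lintegral_comp_perm _ σ hG

lemma MemG.lintegral_jointChar_ne_top [IsProbabilityMeasure P] (hX : MemG H X P) (hH : 0 < H)
    {q : ℕ} (hq : H * (2 * q + d) < 1) {T : ℝ} {U : ℝ → Ω → Space d} {x : Space d}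
    (hUX : ∀ᵐ t ∂(volume.restrict (Set.Ioc 0 T)), ∀ᵐ ω ∂P, U t ω = X t.toNNReal ω + x)
    {n : ℕ} (hn : 1 ≤ n) :
    ∫⁻ z : Fin n → ℝ × Space d,
      (∏ j, ENNReal.ofReal ((1 + ‖(z j).2‖) ^ q)) * ‖jointChar P U z‖ₑ
      ∂(Measure.pi fun _ => (volume.restrict (Set.Ioc 0 T)).prod volume) ≠ ⊤ := by
  obtain ⟨c, hc0, hc⟩ := hX.exists_norm_integral_cexp_le hH hn
  have hGm : Measurable fun z : Fin n → ℝ × Space d =>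
      shearProd (gaussKernel T c H (2 * q)) 0 z :=
    measurable_shearProd_const (measurable_gaussKernel T c H (2 * q)) n 0
  have hperm : ∀ (z : Fin n → ℝ × Space d) (σ : Equiv.Perm (Fin n)),
      (∏ j, ENNReal.ofReal ((1 + ‖((z ∘ σ) j).2‖) ^ q)) * ‖jointChar P U (z ∘ σ)‖ₑ =
        (∏ j, ENNReal.ofReal ((1 + ‖(z j).2‖) ^ q)) * ‖jointChar P U z‖ₑ := by
    intro z σ
    rw [jointChar_comp_perm]
    simp only [Function.comp_apply]
    rw [Equiv.prod_comp σ fun j => ENNReal.ofReal ((1 + ‖(z j).2‖) ^ q)]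
  have hFG : ∀ z : Fin n → ℝ × Space d, (∀ j, (z j).1 ∈ Set.Ioc 0 T ∧
      ∀ᵐ ω ∂P, U (z j).1 ω = X (z j).1.toNNReal ω + x) → (StrictMono fun j => (z j).1) →
      (∏ j, ENNReal.ofReal ((1 + ‖(z j).2‖) ^ q)) * ‖jointChar P U z‖ₑ ≤
        shearProd (gaussKernel T c H (2 * q)) 0 z :=
    fun z hz hmono => le_shearProd_of_strictMono hc (fun j => (hz j).1) (fun j => (hz j).2) hmono
  have hle := lintegral_pi_restrict_le_sum_perm (T := T) (F := fun z : Fin n → ℝ × Space d =>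
    (∏ j, ENNReal.ofReal ((1 + ‖(z j).2‖) ^ q)) * ‖jointChar P U z‖ₑ) hGm hUX hperm hFG
  refine ne_top_of_le_ne_top ?_ hle
  rw [lintegral_shearProd (measurable_gaussKernel T c H (2 * q))]
  refine (ENNReal.sum_lt_top.mpr fun _ _ => ENNReal.pow_lt_top
    (lintegral_gaussKernel_ne_top hc0 hH ?_).lt_top).ne
  push_cast
  exact hq

/-- Under local non-determinism the polynomial weight of degree `q` admits moments of all orders
if `H (2 q + d) < 1`. -/
lemma MemG.isMomentWeight [IsProbabilityMeasure P] (hX : MemG H X P) (hH : 0 < H) {q : ℕ}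
    (hq : H * (2 * q + d) < 1) {T : ℝ} {U : ℝ → Ω → Space d} {x : Space d}
    (hUX : ∀ᵐ t ∂(volume.restrict (Set.Ioc 0 T)), ∀ᵐ ω ∂P, U t ω = X t.toNNReal ω + x) :
    IsMomentWeight P (volume.restrict (Set.Ioc 0 T)) U fun ξ => (1 + ‖ξ‖) ^ q where
  measurable := by fun_prop
  nonneg ξ := by positivity
  even ξ := by rw [norm_neg]
  integrable δ hδ :=
    (integrable_one_add_norm_pow_mul_exp (d := d) q (half_pos hδ)).congr
      (ae_of_all _ fun ξ => mul_comm _ _)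
  lintegral_ne_top n hn := hX.lintegral_jointChar_ne_top hH hq hUX hn

/-- A jointly measurable version of the shifted process. -/
lemma MemG.exists_measurable_version [SFinite P] (hX : MemG H X P) (x : Space d) (T : ℝ) :
    ∃ U : ℝ → Ω → Space d, Measurable (fun z : ℝ × Ω => U z.1 z.2) ∧
      (∀ᵐ t ∂(volume.restrict (Set.Ioc 0 T)), ∀ᵐ ω ∂P, U t ω = X t.toNNReal ω + x) ∧
      ∀ᵐ ω ∂P, ∀ᵐ t ∂(volume.restrict (Set.Ioc 0 T)), U t ω = X t.toNNReal ω + x := by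
  have hY := hX.jointlyMeasurable
  have h1 : ∀ᵐ z : ℝ × Ω ∂((volume.restrict (Set.Ioc (0 : ℝ) T)).prod P),
      hY.mk _ z + x = X z.1.toNNReal z.2 + x := by
    have hac : (volume.restrict (Set.Ioc (0 : ℝ) T)).prod P ≪
        (volume.restrict (Set.Ici (0 : ℝ))).prod P :=
      (Measure.absolutelyContinuous_of_le (Measure.restrict_mono
        (Set.Ioc_subset_Ioi_self.trans Set.Ioi_subset_Ici_self) le_rfl)).prod
        Measure.AbsolutelyContinuous.rfl
    filter_upwards [hac.ae_le hY.ae_eq_mk] with z hz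
    rw [← hz]
  -- Both orders of the quantifiers are needed: fixed times for the characteristic functions, fixed
  -- paths for the time integrals.
  refine ⟨fun t ω => hY.mk _ (t, ω) + x, ?_, Measure.ae_ae_of_ae_prod h1, ?_⟩
  · exact (hY.measurable_mk).add_const x
  · exact Measure.ae_ae_of_ae_prod (Measure.measurePreserving_swap.quasiMeasurePreserving.ae h1)

end MomentWeight

/-! ### Differentiation as multiplication of the Fourier density by a symbol -/

section Derivatives

variable {d : ℕ}

/-- The symbol `∏ (i ξ_l)^{k_l}` of the mixed partial derivative of order `k`. -/
def symbol (k : Fin d → ℕ) (ξ : Space d) : ℂ :=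
  ∏ l, (Complex.I * ((ξ l : ℝ) : ℂ)) ^ k l

/-- The measurable functions that are integrable against all the powers of the norm. -/
def IsRapid (h : Space d → ℂ) : Prop :=
  AEStronglyMeasurable h ∧ ∀ n : ℕ, Integrable fun ξ => ‖ξ‖ ^ n * ‖h ξ‖

lemma IsRapid.integrable {h : Space d → ℂ} (hh : IsRapid h) : Integrable h := by
  have := hh.2 0
  simp only [pow_zero, one_mul] at this
  exact (integrable_norm_iff hh.1).mp this

lemma abs_coord_le_norm (ξ : Space d) (i : Fin d) : |ξ i| ≤ ‖ξ‖ := by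
  simpa using PiLp.norm_apply_le ξ i

lemma IsRapid.coord_mul {h : Space d → ℂ} (hh : IsRapid h) (i : Fin d) :
    IsRapid fun ξ => Complex.I * ((ξ i : ℝ) : ℂ) * h ξ := by
  have hm : Measurable fun ξ : Space d => Complex.I * ((ξ i : ℝ) : ℂ) := by fun_prop
  refine ⟨hm.aestronglyMeasurable.mul hh.1, fun n => ?_⟩
  refine (hh.2 (n + 1)).mono'
    ((by fun_prop : Measurable fun ξ : Space d => ‖ξ‖ ^ n).aestronglyMeasurable.mul
      (hm.aestronglyMeasurable.mul hh.1).norm) (ae_of_all _ fun ξ => ?_)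
  rw [Real.norm_of_nonneg (by positivity), norm_mul, norm_mul, Complex.norm_I, one_mul,
    Complex.norm_real, pow_succ, mul_assoc]
  gcongr
  exact abs_coord_le_norm ξ i

lemma inner_single_right (ξ : Space d) (i : Fin d) :
    inner ℝ ξ (EuclideanSpace.single i (1 : ℝ)) = ξ i := by
  simp [EuclideanSpace.inner_single_right]

/-- Differentiation under the integral sign; the differentiated integrand has the modulus `|ξ_i|
|h(ξ)|`, an integrable bound uniform in the increment. -/
lemma hasLineDerivAt_fourierSynth {h : Space d → ℂ} (hh : IsRapid h) (i : Fin d) (y : Space d) :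
    HasLineDerivAt ℝ (fourierSynth h)
      (fourierSynth (fun ξ => Complex.I * ((ξ i : ℝ) : ℂ) * h ξ) y) y
      (EuclideanSpace.single i 1) := by
  have hg := hh.coord_mul i
  unfold HasLineDerivAt fourierSynth
  have key := hasDerivAt_integral_of_dominated_loc_of_deriv_le (μ := (volume : Measure (Space d)))
    (F := fun (t : ℝ) ξ => h ξ * Complex.exp (Complex.I *
      ((inner ℝ ξ (y + t • EuclideanSpace.single i (1 : ℝ)) : ℝ) : ℂ)))
    (F' := fun (t : ℝ) ξ => Complex.I * ((ξ i : ℝ) : ℂ) * h ξ * Complex.exp (Complex.I *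
      ((inner ℝ ξ (y + t • EuclideanSpace.single i (1 : ℝ)) : ℝ) : ℂ)))
    (x₀ := (0 : ℝ)) (s := Set.univ) (bound := fun ξ => ‖Complex.I * ((ξ i : ℝ) : ℂ) * h ξ‖)
    univ_mem
    (Eventually.of_forall fun t => (integrable_mul_cexp hh.integrable (by fun_prop)).1)
    (integrable_mul_cexp hh.integrable (by fun_prop))
    (integrable_mul_cexp hg.integrable (by fun_prop)).1
    (ae_of_all _ fun ξ t _ => by rw [norm_mul, norm_cexp_I_mul_ofReal, mul_one])
    hg.integrable.norm
    (ae_of_all _ fun ξ t _ => ?_)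
  · simpa using key.2
  · have h1 : HasDerivAt (fun t : ℝ => ((inner ℝ ξ (y + t • EuclideanSpace.single i (1 : ℝ)) : ℝ)
        : ℂ)) ((ξ i : ℝ) : ℂ) t := by
      refine HasDerivAt.ofReal_comp ?_
      simp only [inner_add_right, inner_smul_right, inner_single_right]
      simpa using ((hasDerivAt_id t).mul_const (ξ i)).const_add (inner ℝ ξ y)
    refine (((h1.const_mul Complex.I).cexp).const_mul (h ξ)).congr_deriv ?_
    ring

/-- The partial derivatives of a function whose composition with an embedding of the values into
`ℂ` has a rapidly decaying Fourier density. -/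
lemma fourierSynth_partialDeriv {V : Type*} [NormedAddCommGroup V] [NormedSpace ℝ V]
    (J : V →L[ℝ] ℂ) (R : ℂ →L[ℝ] V) (hRJ : ∀ v, R (J v) = v) {g : Space d → V}
    {h : Space d → ℂ} (hh : IsRapid h) (hg : ∀ y, J (g y) = fourierSynth h y) (i : Fin d)
    (y : Space d) :
    J (partialDeriv i g y) = fourierSynth (fun ξ => Complex.I * ((ξ i : ℝ) : ℂ) * h ξ) y := by
  have h1 := hasLineDerivAt_fourierSynth hh i y
  have hfun : (fun y => J (g y)) = fourierSynth h := funext hg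
  rw [← hfun] at h1
  -- The left inverse `R` transfers differentiability from `J ∘ g` back to `g`; without it
  -- `lineDeriv` might be the default value zero.
  have h2 : HasLineDerivAt ℝ g
      (R (fourierSynth (fun ξ => Complex.I * ((ξ i : ℝ) : ℂ) * h ξ) y)) y
      (EuclideanSpace.single i 1) := by
    have := R.hasFDerivAt.comp_hasDerivAt 0 (h1 : HasDerivAt _ _ _)
    simpa only [HasLineDerivAt, Function.comp_def, hRJ] using this
  have h3 : HasLineDerivAt ℝ (fun y => J (g y))
      (J (R (fourierSynth (fun ξ => Complex.I * ((ξ i : ℝ) : ℂ) * h ξ) y))) y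
      (EuclideanSpace.single i 1) :=
    J.hasFDerivAt.comp_hasDerivAt 0 (h2 : HasDerivAt _ _ _)
  rw [partialDeriv, h2.lineDeriv]
  exact h3.unique h1

lemma fourierSynth_iterate_partialDeriv {V : Type*} [NormedAddCommGroup V] [NormedSpace ℝ V]
    (J : V →L[ℝ] ℂ) (R : ℂ →L[ℝ] V) (hRJ : ∀ v, R (J v) = v) {g : Space d → V}
    {h : Space d → ℂ} (hh : IsRapid h) (hg : ∀ y, J (g y) = fourierSynth h y) (i : Fin d)
    (m : ℕ) :
    IsRapid (fun ξ => (Complex.I * ((ξ i : ℝ) : ℂ)) ^ m * h ξ) ∧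
    ∀ y, J ((partialDeriv i)^[m] g y) =
      fourierSynth (fun ξ => (Complex.I * ((ξ i : ℝ) : ℂ)) ^ m * h ξ) y := by
  induction m with
  | zero => simpa using ⟨hh, hg⟩
  | succ m ih =>
    simp only [Function.iterate_succ_apply', pow_succ', mul_assoc]
    simp only [← mul_assoc Complex.I]
    exact ⟨ih.1.coord_mul i, fourierSynth_partialDeriv J R hRJ ih.1 ih.2 i⟩

lemma fourierSynth_multiDeriv {V : Type*} [NormedAddCommGroup V] [NormedSpace ℝ V]
    (J : V →L[ℝ] ℂ) (R : ℂ →L[ℝ] V) (hRJ : ∀ v, R (J v) = v) {g : Space d → V}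
    {h : Space d → ℂ} (hh : IsRapid h) (hg : ∀ y, J (g y) = fourierSynth h y)
    (k : Fin d → ℕ) :
    IsRapid (fun ξ => symbol k ξ * h ξ) ∧
    ∀ y, J (multiDeriv k g y) = fourierSynth (fun ξ => symbol k ξ * h ξ) y := by
  have key : ∀ l : List (Fin d),
      IsRapid (fun ξ => (l.map fun i => (Complex.I * ((ξ i : ℝ) : ℂ)) ^ k i).prod * h ξ) ∧
      ∀ y, J (l.foldr (fun i h => (partialDeriv i)^[k i] h) g y) =
        fourierSynth (fun ξ => (l.map fun i => (Complex.I * ((ξ i : ℝ) : ℂ)) ^ k i).prod * h ξ)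
          y := by
    intro l
    induction l with
    | nil => simpa using ⟨hh, hg⟩
    | cons i l ih =>
      simp only [List.map_cons, List.prod_cons, List.foldr_cons, mul_assoc]
      exact fourierSynth_iterate_partialDeriv J R hRJ ih.1 ih.2 i (k i)
  have h1 := key (List.finRange d)
  simp only [← Fin.prod_univ_def] at h1
  exact h1

end Derivatives

/-! ### Fourier densities of the heat kernel and of scaled Schwartz functions -/

section Synthesis

variable {d : ℕ}

lemma norm_symbol_le (k : Fin d → ℕ) (ξ : Space d) : ‖symbol k ξ‖ ≤ ‖ξ‖ ^ order k := by
  rw [symbol, norm_prod, order, ← Finset.prod_pow_eq_pow_sum]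
  refine Finset.prod_le_prod (fun _ _ => norm_nonneg _) fun l _ => ?_
  rw [norm_pow, norm_mul, Complex.norm_I, one_mul, Complex.norm_real]
  exact pow_le_pow_left₀ (norm_nonneg _) (abs_coord_le_norm ξ l) _

lemma measurable_symbol (k : Fin d → ℕ) : Measurable (symbol k) := by
  unfold symbol
  fun_prop

lemma symbol_smul (k : Fin d → ℕ) (r : ℝ) (ξ : Space d) :
    symbol k (r • ξ) = ((r ^ order k : ℝ) : ℂ) * symbol k ξ := by
  simp only [symbol, order, ← Finset.prod_pow_eq_pow_sum, Complex.ofReal_prod,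
    ← Finset.prod_mul_distrib]
  refine Finset.prod_congr rfl fun l _ => ?_
  simp only [PiLp.smul_apply, smul_eq_mul]
  push_cast
  rw [← mul_pow]
  ring

lemma symbol_shiftIndex {N : ℕ} (k : Fin d → ℕ) (i : Fin N → Fin d) (ξ : Space d) :
    symbol (shiftIndex k i) ξ = symbol k ξ * ∏ j, (Complex.I * ((ξ (i j) : ℝ) : ℂ)) := by
  have hpow : ∀ l : Fin d,
      (Complex.I * ((ξ l : ℝ) : ℂ)) ^ (∑ j, Pi.single (i j) 1 : Fin d → ℕ) l =
        ∏ j, (Complex.I * ((ξ l : ℝ) : ℂ)) ^ (Pi.single (i j) 1 : Fin d → ℕ) l := fun l => by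
    rw [Finset.sum_apply, ← Finset.prod_pow_eq_pow_sum]
  simp only [symbol, shiftIndex, Pi.add_apply, pow_add, Finset.prod_mul_distrib, hpow]
  congr 1
  rw [Finset.prod_comm, ← Finset.prod_mul_distrib]
  refine Finset.prod_congr rfl fun j _ => ?_
  refine (Finset.prod_eq_single (i j) (fun l _ hl => by simp [hl]) (by simp)).trans ?_
  simp

lemma order_shiftIndex {N : ℕ} (k : Fin d → ℕ) (i : Fin N → Fin d) :
    order (shiftIndex k i) = order k + N := by
  simp only [order, shiftIndex, Pi.add_apply, Finset.sum_add_distrib, Finset.sum_apply]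
  rw [Finset.sum_comm]
  simp

/-- The constant `(2π)^{-d}` of the Fourier inversion formula. -/
def invConst (d : ℕ) : ℂ := (((2 * Real.pi) ^ d : ℝ) : ℂ)⁻¹

lemma fourierHat_eq_fourier (f : Space d → ℂ) (y : Space d) :
    fourierHat f y = FourierTransform.fourier f ((2 * Real.pi)⁻¹ • y) := by
  rw [Real.fourier_eq', fourierHat]
  congr 1 with u
  rw [smul_eq_mul, mul_comm, inner_smul_right, real_inner_comm]
  congr 2
  push_cast
  have : (Real.pi : ℂ) ≠ 0 := Complex.ofReal_ne_zero.mpr Real.pi_ne_zero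
  field_simp

/-- Fourier inversion; the dilation by `2π` between the two normalisations produces the constant
`(2π)^{-d}`. -/
lemma fourierSynth_fourierHat (f : 𝓢(Space d, ℂ)) (y : Space d) :
    f y = fourierSynth (fun ξ => invConst d * fourierHat f ξ) y := by
  have h1 : f y = FourierTransformInv.fourierInv (FourierTransform.fourier (f : Space d → ℂ)) y := by
    rw [← SchwartzMap.fourier_coe, ← SchwartzMap.fourierInv_coe,
      FourierTransform.fourierInv_fourier_eq]
  rw [h1, Real.fourierInv_eq']
  have h2 := Measure.integral_comp_inv_smul (volume : Measure (Space d))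
    (fun v => Complex.exp (((2 * Real.pi * inner ℝ v y : ℝ) : ℂ) * Complex.I) •
      FourierTransform.fourier (f : Space d → ℂ) v) (2 * Real.pi)
  rw [abs_of_pos (by positivity), finrank_euclideanSpace_fin] at h2
  rw [fourierSynth_const_mul, invConst, eq_inv_mul_iff_mul_eq₀
    (Complex.ofReal_ne_zero.mpr (by positivity)), ← Complex.real_smul, ← h2, fourierSynth]
  congr 1 with ξ
  rw [fourierHat_eq_fourier, smul_eq_mul, mul_comm, inner_smul_left]
  congr 2
  simp only [conj_trivial]
  rw [← mul_assoc, mul_inv_cancel₀ (by positivity), one_mul, mul_comm]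

lemma isRapid_fourierHat (f : 𝓢(Space d, ℂ)) : IsRapid (fourierHat (f : Space d → ℂ)) := by
  have h0 : (fourierHat (f : Space d → ℂ)) =
      fun y => (FourierTransform.fourier f : 𝓢(Space d, ℂ)) ((2 * Real.pi)⁻¹ • y) := by
    ext y
    rw [fourierHat_eq_fourier, SchwartzMap.fourier_coe]
  refine ⟨?_, fun n => ?_⟩
  · rw [h0]
    exact ((FourierTransform.fourier f : 𝓢(Space d, ℂ)).continuous.comp
      (continuous_const_smul _)).aestronglyMeasurable
  · have h1 := ((FourierTransform.fourier f : 𝓢(Space d, ℂ)).integrable_pow_mul volume n).comp_smul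
      (R := (2 * Real.pi)⁻¹) (by positivity)
    refine (h1.const_mul ((2 * Real.pi) ^ n)).congr (ae_of_all _ fun ξ => ?_)
    simp only [h0, norm_smul]
    rw [mul_pow ‖(2 * Real.pi)⁻¹‖]
    have h2 : (2 * Real.pi) ^ n * (2 * Real.pi)⁻¹ ^ n = 1 := by
      rw [← mul_pow, mul_inv_cancel₀ (by positivity), one_pow]
    rw [Real.norm_of_nonneg (by positivity), ← mul_assoc, ← mul_assoc, h2, one_mul]

/-- The heat kernel is a damped constant on the Fourier side. For this reason the regularisation by
`damp` reproduces the approximations of the local time exactly. -/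
lemma heatKernel_eq_fourierSynth {ε : ℝ} (hε : 0 < ε) (y : Space d) :
    ((heatKernel ε y : ℝ) : ℂ) = fourierSynth (damp ε fun _ => invConst d) y := by
  have hb : 0 < ((ε / 2 : ℝ) : ℂ).re := by simpa using hε
  have h1 := GaussianFourier.integral_cexp_neg_mul_sq_norm_add hb Complex.I y
  rw [finrank_euclideanSpace_fin] at h1
  have h2 : fourierSynth (damp ε fun _ => invConst d) y =
      invConst d * ∫ v : Space d, Complex.exp (-((ε / 2 : ℝ) : ℂ) * ‖v‖ ^ 2 +
        Complex.I * ((inner ℝ y v : ℝ) : ℂ)) := by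
    rw [fourierSynth, ← integral_const_mul]
    congr 1 with ξ
    rw [Complex.exp_add, damp, real_inner_comm]
    push_cast
    ring
  rw [h2, h1, heatKernel, invConst]
  have h3 : ((Real.pi : ℂ) / ((ε / 2 : ℝ) : ℂ)) ^ ((d : ℂ) / 2) =
      (((2 * Real.pi / ε) ^ ((d : ℝ) / 2) : ℝ) : ℂ) := by
    rw [Complex.ofReal_cpow (by positivity)]
    push_cast
    congr 1
    field_simp
  have h4 : Complex.exp (Complex.I ^ 2 * (‖y‖ : ℂ) ^ 2 / (4 * ((ε / 2 : ℝ) : ℂ))) =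
      ((Real.exp (-(1 / (2 * ε)) * ‖y‖ ^ 2) : ℝ) : ℂ) := by
    rw [Complex.ofReal_exp]
    congr 1
    have : (ε : ℂ) ≠ 0 := Complex.ofReal_ne_zero.mpr hε.ne'
    push_cast
    rw [Complex.I_sq]
    field_simp
    ring
  rw [h3, h4, ← mul_assoc, ← Complex.ofReal_inv, ← Complex.ofReal_mul, ← Complex.ofReal_mul]
  congr 2
  have h5 : (2 * Real.pi) ^ d = (2 * Real.pi) ^ ((d : ℝ) / 2) * (2 * Real.pi) ^ ((d : ℝ) / 2) := by
    rw [← Real.rpow_add (by positivity), add_halves, Real.rpow_natCast]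
  rw [h5, Real.div_rpow (by positivity) hε.le, Real.mul_rpow (by positivity) hε.le]
  have := (Real.rpow_pos_of_pos (by positivity : 0 < 2 * Real.pi) ((d : ℝ) / 2)).ne'
  have := (Real.rpow_pos_of_pos hε ((d : ℝ) / 2)).ne'
  field_simp

lemma isRapid_damp_const {ε : ℝ} (hε : 0 < ε) (c : ℂ) :
    IsRapid (damp (d := d) ε fun _ => c) := by
  refine ⟨(measurable_damp measurable_const ε).aestronglyMeasurable, fun n => ?_⟩
  refine ((integrable_one_add_norm_pow_mul_exp (d := d) n (half_pos hε)).mul_const ‖c‖).mono'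
    ?_ (ae_of_all _ fun ξ => ?_)
  · exact ((by fun_prop : Measurable fun ξ : Space d => ‖ξ‖ ^ n).mul
      (measurable_damp measurable_const ε).norm).aestronglyMeasurable
  · rw [Real.norm_of_nonneg (by positivity), damp, norm_mul, Complex.norm_real,
      Real.norm_of_nonneg (Real.exp_pos _).le, ← mul_assoc]
    gcongr
    linarith

/-- The mixed derivatives of the heat kernel by means of their Fourier densities. -/
lemma multiDeriv_heatKernel {ε : ℝ} (hε : 0 < ε) (k : Fin d → ℕ) (y : Space d) :
    ((multiDeriv k (heatKernel ε) y : ℝ) : ℂ) =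
      fourierSynth (damp ε fun ξ => invConst d * symbol k ξ) y := by
  have h := (fourierSynth_multiDeriv Complex.ofRealCLM Complex.reCLM (fun v => by simp)
    (g := heatKernel ε) (isRapid_damp_const hε (invConst d)) (fun y => heatKernel_eq_fourierSynth hε y) k).2 y
  rw [Complex.ofRealCLM_apply] at h
  rw [h]
  congr 1
  ext ξ
  simp only [damp]
  ring

/-- The scaled mixed derivatives of a Schwartz function by means of their Fourier densities. -/
lemma multiDeriv_schwartz (f : 𝓢(Space d, ℂ)) (k : Fin d → ℕ) {r : ℝ} (hr : 0 < r) :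
    Integrable (fun ξ => invConst d * symbol k ξ * fourierHat f (r • ξ)) ∧
    ∀ y : Space d, (((r ^ (order k + d))⁻¹ : ℝ) : ℂ) * multiDeriv k (⇑f) (r⁻¹ • y) =
      fourierSynth (fun ξ => invConst d * symbol k ξ * fourierHat f (r • ξ)) y := by
  have hrap : IsRapid fun ξ => invConst d * fourierHat f ξ := by
    refine ⟨(isRapid_fourierHat f).1.const_mul _, fun n => ?_⟩
    refine (((isRapid_fourierHat f).2 n).const_mul ‖invConst d‖).congr (ae_of_all _ fun ξ => ?_)
    simp only [norm_mul]
    ring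
  obtain ⟨h1, h2⟩ := fourierSynth_multiDeriv (ContinuousLinearMap.id ℝ ℂ)
    (ContinuousLinearMap.id ℝ ℂ) (fun v => rfl) (g := ⇑f) hrap (fun y => fourierSynth_fourierHat f y) k
  have hfun : ∀ ξ : Space d, symbol k (r • ξ) * (invConst d * fourierHat f (r • ξ)) =
      ((r ^ order k : ℝ) : ℂ) * (invConst d * symbol k ξ * fourierHat f (r • ξ)) := by
    intro ξ
    rw [symbol_smul]
    ring
  have hrk : ((r ^ order k : ℝ) : ℂ) ≠ 0 := Complex.ofReal_ne_zero.mpr (by positivity)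
  refine ⟨?_, fun y => ?_⟩
  · have h3 := h1.integrable.comp_smul (R := r) hr.ne'
    simp only [hfun] at h3
    exact (integrable_const_mul_iff (isUnit_iff_ne_zero.mpr hrk) _).mp h3
  · have h4 := h2 (r⁻¹ • y)
    rw [ContinuousLinearMap.id_apply] at h4
    have h5 := Measure.integral_comp_smul (volume : Measure (Space d))
      (fun ξ => symbol k ξ * (invConst d * fourierHat f ξ) *
        Complex.exp (Complex.I * ((inner ℝ ξ (r⁻¹ • y) : ℝ) : ℂ))) r
    rw [finrank_euclideanSpace_fin, abs_of_pos (by positivity)] at h5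
    have h6 : fourierSynth (fun ξ => symbol k ξ * (invConst d * fourierHat f ξ)) (r⁻¹ • y) =
        ((r ^ d : ℝ) : ℂ) * (((r ^ order k : ℝ) : ℂ) *
          fourierSynth (fun ξ => invConst d * symbol k ξ * fourierHat f (r • ξ)) y) := by
      rw [← fourierSynth_const_mul]
      have h7 : fourierSynth (fun ξ => ((r ^ order k : ℝ) : ℂ) *
          (invConst d * symbol k ξ * fourierHat f (r • ξ))) y =
          (r ^ d)⁻¹ • fourierSynth (fun ξ => symbol k ξ * (invConst d * fourierHat f ξ))
            (r⁻¹ • y) := by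
        unfold fourierSynth
        rw [← h5]
        congr 1 with ξ
        rw [hfun, inner_smul_left, inner_smul_right, conj_trivial, ← mul_assoc r,
          mul_inv_cancel₀ hr.ne', one_mul]
      rw [h7, Complex.real_smul, ← mul_assoc, ← Complex.ofReal_mul,
        mul_inv_cancel₀ (by positivity), Complex.ofReal_one, one_mul]
    rw [h4, h6, ← mul_assoc, ← mul_assoc, ← Complex.ofReal_mul, ← Complex.ofReal_mul, pow_add]
    have h8 : (r ^ order k * r ^ d)⁻¹ * r ^ d * r ^ order k = 1 := by field_simp
    rw [h8, Complex.ofReal_one, one_mul]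

end Synthesis

/-! ### Taylor expansion of the Fourier transform at the origin -/

section Taylor

variable {d : ℕ}

/-- The remainder of the Taylor expansion of `exp (i x)` of order `n`. -/
def expRem (n : ℕ) (x : ℝ) : ℂ :=
  Complex.exp (Complex.I * x) - ∑ m ∈ Finset.range n, (Complex.I * x) ^ m / (m.factorial : ℂ)

/-- For `|x| ≤ 1` this is the Taylor estimate; for `|x| ≥ 1` every subtracted term, and the
exponential itself, is at most a constant times `|x|^n`. -/
lemma exists_norm_expRem_le (n : ℕ) : ∃ C : ℝ, 0 ≤ C ∧ ∀ x : ℝ, ‖expRem n x‖ ≤ C * |x| ^ n := by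
  have hnorm : ∀ x : ℝ, ‖Complex.I * (x : ℂ)‖ = |x| := fun x => by simp
  refine ⟨Real.exp 1 + (1 + ∑ m ∈ Finset.range n, 1 / (m.factorial : ℝ)), by positivity,
    fun x => ?_⟩
  rcases le_total |x| 1 with hx | hx
  · refine (Complex.norm_exp_sub_sum_le_norm_mul_exp (Complex.I * x) n).trans ?_
    rw [hnorm, mul_comm]
    gcongr
    have h1 : Real.exp |x| ≤ Real.exp 1 := Real.exp_le_exp.mpr hx
    have h2 : 0 ≤ ∑ m ∈ Finset.range n, 1 / (m.factorial : ℝ) := by positivity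
    linarith
  · have h1 : ‖expRem n x‖ ≤ 1 + ∑ m ∈ Finset.range n, |x| ^ m / (m.factorial : ℝ) := by
      refine (norm_sub_le _ _).trans (add_le_add (norm_cexp_I_mul_ofReal x).le ?_)
      refine (norm_sum_le _ _).trans (Finset.sum_le_sum fun m _ => ?_)
      rw [norm_div, norm_pow, hnorm, Complex.norm_natCast]
    have h2 : ∑ m ∈ Finset.range n, |x| ^ m / (m.factorial : ℝ) ≤
        (∑ m ∈ Finset.range n, 1 / (m.factorial : ℝ)) * |x| ^ n := by
      rw [Finset.sum_mul]
      refine Finset.sum_le_sum fun m hm => ?_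
      rw [one_div, inv_mul_eq_div]
      exact div_le_div_of_nonneg_right (pow_le_pow_right₀ hx (Finset.mem_range.mp hm).le)
        (by positivity)
    have h3 : 1 ≤ |x| ^ n := one_le_pow₀ hx
    have h4 : 0 ≤ Real.exp 1 * |x| ^ n := by positivity
    nlinarith

/-- Giving up one order of smallness saves one power of growth. The domination of the error needs
this, since the weight allows only `N` powers of `|ξ|` beyond those of the symbol. -/
lemma exists_norm_expRem_succ_le (n : ℕ) :
    ∃ C : ℝ, 0 ≤ C ∧ ∀ x : ℝ, ‖expRem (n + 1) x‖ ≤ C * |x| ^ n := by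
  obtain ⟨C, hC, h⟩ := exists_norm_expRem_le n
  refine ⟨C + 1, by positivity, fun x => ?_⟩
  have h1 : expRem (n + 1) x = expRem n x - (Complex.I * x) ^ n / (n.factorial : ℂ) := by
    simp only [expRem, Finset.sum_range_succ]
    ring
  rw [h1, add_mul, one_mul]
  refine (norm_sub_le _ _).trans (add_le_add (h x) ?_)
  rw [norm_div, norm_pow, Complex.norm_natCast]
  simp only [norm_mul, Complex.norm_I, one_mul, Complex.norm_real, Real.norm_eq_abs]
  exact div_le_self (by positivity) (by exact_mod_cast n.factorial_pos)

lemma norm_integral_mul_comp_inner_le (f : 𝓢(Space d, ℂ)) {E : ℝ → ℂ} {C : ℝ} {n : ℕ}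
    (hC : 0 ≤ C) (hE : ∀ x, ‖E x‖ ≤ C * |x| ^ n) {s : ℝ} (hs : 0 ≤ s) (ξ : Space d) :
    ‖∫ v, f v * E (-(s * inner ℝ ξ v))‖ ≤
      s ^ n * (C * (∫ v, ‖v‖ ^ n * ‖f v‖)) * ‖ξ‖ ^ n := by
  have h1 : s ^ n * (C * (∫ v, ‖v‖ ^ n * ‖f v‖)) * ‖ξ‖ ^ n =
      ∫ v, (s ^ n * C * ‖ξ‖ ^ n) * (‖v‖ ^ n * ‖f v‖) := by
    rw [integral_const_mul]; ring
  rw [h1]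
  refine norm_integral_le_of_norm_le ((f.integrable_pow_mul volume n).const_mul _)
    (ae_of_all _ fun v => ?_)
  rw [norm_mul]
  have h2 : |(-(s * inner ℝ ξ v))| ≤ s * (‖ξ‖ * ‖v‖) := by
    rw [abs_neg, abs_mul, abs_of_nonneg hs]
    gcongr
    exact abs_real_inner_le_norm ξ v
  calc ‖f v‖ * ‖E (-(s * inner ℝ ξ v))‖ ≤ ‖f v‖ * (C * (s * (‖ξ‖ * ‖v‖)) ^ n) := by
        gcongr
        exact (hE _).trans (by gcongr)
    _ = _ := by rw [mul_pow, mul_pow]; ring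

lemma integrable_mul_inner_pow (f : 𝓢(Space d, ℂ)) (ξ : Space d) (m : ℕ) :
    Integrable fun v : Space d => f v * ((inner ℝ ξ v : ℝ) : ℂ) ^ m := by
  have hm : Measurable fun v : Space d => ((inner ℝ ξ v : ℝ) : ℂ) ^ m := by fun_prop
  refine ((f.integrable_pow_mul volume m).const_mul (‖ξ‖ ^ m)).mono'
    (f.continuous.aestronglyMeasurable.mul hm.aestronglyMeasurable) (ae_of_all _ fun v => ?_)
  rw [norm_mul, norm_pow, Complex.norm_real, Real.norm_eq_abs]
  calc ‖f v‖ * |inner ℝ ξ v| ^ m ≤ ‖f v‖ * (‖ξ‖ * ‖v‖) ^ m := by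
        gcongr
        exact abs_real_inner_le_norm ξ v
    _ = _ := by rw [mul_pow]; ring

lemma integrable_prod_coord_mul (f : 𝓢(Space d, ℂ)) {m : ℕ} (i : Fin m → Fin d) :
    Integrable fun v : Space d => (∏ j, ((v (i j) : ℝ) : ℂ)) * f v := by
  have hm : Measurable fun v : Space d => ∏ j, ((v (i j) : ℝ) : ℂ) := by fun_prop
  refine (f.integrable_pow_mul volume m).mono'
    (hm.aestronglyMeasurable.mul f.continuous.aestronglyMeasurable) (ae_of_all _ fun v => ?_)
  rw [norm_mul, norm_prod]
  gcongr
  calc ∏ j, ‖((v (i j) : ℝ) : ℂ)‖ ≤ ∏ _j : Fin m, ‖v‖ := by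
        refine Finset.prod_le_prod (fun _ _ => norm_nonneg _) fun j _ => ?_
        rw [Complex.norm_real]
        exact abs_coord_le_norm v (i j)
    _ = ‖v‖ ^ m := by simp

/-- Expanding the power of the sum `ξ·v` over all index tuples separates the frequencies from the
moments. -/
lemma integral_mul_inner_pow (f : 𝓢(Space d, ℂ)) (ξ : Space d) (m : ℕ) :
    ∫ v, f v * ((inner ℝ ξ v : ℝ) : ℂ) ^ m =
      ∑ i : Fin m → Fin d, (∏ j, ((ξ (i j) : ℝ) : ℂ)) * moment f i := by
  have h1 : ∀ v : Space d, f v * ((inner ℝ ξ v : ℝ) : ℂ) ^ m =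
      ∑ i : Fin m → Fin d, (∏ j, ((ξ (i j) : ℝ) : ℂ)) * ((∏ j, ((v (i j) : ℝ) : ℂ)) * f v) := by
    intro v
    have h2 : ((inner ℝ ξ v : ℝ) : ℂ) = ∑ l, ((ξ l : ℝ) : ℂ) * ((v l : ℝ) : ℂ) := by
      rw [PiLp.inner_apply, Complex.ofReal_sum]
      refine Finset.sum_congr rfl fun l _ => ?_
      simp [mul_comm]
    rw [h2, Fintype.sum_pow, Finset.mul_sum]
    refine Finset.sum_congr rfl fun i _ => ?_
    rw [Finset.prod_mul_distrib]
    ring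
  simp only [h1]
  rw [integral_finsetSum _ fun i _ => (integrable_prod_coord_mul f i).const_mul _]
  simp only [integral_const_mul, moment]

/-- The Taylor expansion of the Fourier transform of a Schwartz function with vanishing moments. -/
lemma fourierHat_taylor {N : ℕ} (hN : 1 ≤ N) {f : 𝓢(Space d, ℂ)}
    (hf : f ∈ schwartzVanishing d N) {s : ℝ} (hs : 0 < s) (ξ : Space d) :
    (((s ^ N)⁻¹ : ℝ) : ℂ) * (fourierHat f (s • ξ) - fourierHat f 0) -
      (-1 : ℂ) ^ N / (N.factorial : ℂ) *
        ∑ i : Fin N → Fin d, (∏ j, (Complex.I * ((ξ (i j) : ℝ) : ℂ))) * moment f i =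
      (((s ^ N)⁻¹ : ℝ) : ℂ) * ∫ v, f v * expRem (N + 1) (-(s * inner ℝ ξ v)) := by
  set t : ℕ → Space d → ℂ := fun m v =>
    (Complex.I * ((-(s * inner ℝ ξ v) : ℝ) : ℂ)) ^ m / (m.factorial : ℂ) with ht
  have ht' : ∀ m v, f v * t m v =
      ((-Complex.I * s) ^ m / (m.factorial : ℂ)) * (f v * ((inner ℝ ξ v : ℝ) : ℂ) ^ m) := by
    intro m v
    have : Complex.I * ((-(s * inner ℝ ξ v) : ℝ) : ℂ) =
        (-Complex.I * s) * ((inner ℝ ξ v : ℝ) : ℂ) := by push_cast; ring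
    simp only [ht, this, mul_pow (-Complex.I * (s : ℂ))]
    ring
  have hti : ∀ m, Integrable fun v => f v * t m v := by
    intro m
    simp only [ht']
    exact (integrable_mul_inner_pow f ξ m).const_mul _
  have hint : ∀ m, ∫ v, f v * t m v = ((-Complex.I * s) ^ m / (m.factorial : ℂ)) *
      ∑ i : Fin m → Fin d, (∏ j, ((ξ (i j) : ℝ) : ℂ)) * moment f i := by
    intro m
    simp only [ht']
    rw [integral_const_mul, integral_mul_inner_pow]
  have h0 : ∫ v, f v * t 0 v = fourierHat f 0 := by
    simp [ht, fourierHat]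
  have hvan : ∀ m, 1 ≤ m → m < N → ∫ v, f v * t m v = 0 := by
    intro m hm hmN
    rw [hint, Finset.sum_eq_zero, mul_zero]
    intro i _
    rw [hf m hm hmN i, mul_zero]
  have hE : ∫ v, f v * expRem (N + 1) (-(s * inner ℝ ξ v)) =
      fourierHat f (s • ξ) - (fourierHat f 0 + ∫ v, f v * t N v) := by
    have h1 : ∀ v, f v * expRem (N + 1) (-(s * inner ℝ ξ v)) =
        f v * Complex.exp (Complex.I * ((-(s * inner ℝ ξ v) : ℝ) : ℂ)) -
          ∑ m ∈ Finset.range (N + 1), f v * t m v := by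
      intro v
      rw [expRem, mul_sub, Finset.mul_sum]
    simp only [h1]
    rw [integral_sub (integrable_mul_cexp f.integrable (by fun_prop))
      (integrable_finsetSum _ fun m _ => hti m), integral_finsetSum _ fun m _ => hti m,
      Finset.sum_range_succ]
    congr 1
    · rw [fourierHat]
      congr 1 with v
      rw [inner_smul_left, conj_trivial]
      congr 2
      push_cast
      ring
    · congr 1
      -- The term of order zero is split off as `f̂(0)`; the orders `1, …, N - 1` vanish, which
      -- leaves the order `N`.
      obtain ⟨M, rfl⟩ : ∃ M, N = M + 1 := ⟨N - 1, by omega⟩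
      rw [Finset.sum_range_succ', h0, Finset.sum_eq_zero, zero_add]
      intro m hm
      exact hvan (m + 1) (by omega) (by simpa using hm)
  have hs' : (s : ℂ) ≠ 0 := Complex.ofReal_ne_zero.mpr hs.ne'
  have hsum : ∑ i : Fin N → Fin d, (∏ j, (Complex.I * ((ξ (i j) : ℝ) : ℂ))) * moment f i =
      Complex.I ^ N * ∑ i : Fin N → Fin d, (∏ j, ((ξ (i j) : ℝ) : ℂ)) * moment f i := by
    rw [Finset.mul_sum]
    refine Finset.sum_congr rfl fun i _ => ?_
    rw [Finset.prod_mul_distrib, Finset.prod_const, Finset.card_univ, Fintype.card_fin]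
    ring
  rw [hE, hint N, hsum, mul_pow, neg_pow Complex.I]
  push_cast
  have hsN : (s : ℂ) ^ N ≠ 0 := pow_ne_zero _ hs'
  field_simp
  ring

lemma continuous_fourierHat (f : 𝓢(Space d, ℂ)) : Continuous (fourierHat (f : Space d → ℂ)) := by
  have h0 : (fourierHat (f : Space d → ℂ)) =
      fun y => (FourierTransform.fourier f : 𝓢(Space d, ℂ)) ((2 * Real.pi)⁻¹ • y) := by
    ext y
    rw [fourierHat_eq_fourier, SchwartzMap.fourier_coe]
  rw [h0]
  exact (FourierTransform.fourier f : 𝓢(Space d, ℂ)).continuous.comp (continuous_const_smul _)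

lemma norm_fourierHat_le (f : Space d → ℂ) (y : Space d) : ‖fourierHat f y‖ ≤ ∫ u, ‖f u‖ := by
  refine (norm_integral_le_integral_norm _).trans_eq (integral_congr_ae (ae_of_all _ fun u => ?_))
  have : -Complex.I * ((inner ℝ y u : ℝ) : ℂ) = Complex.I * ((-inner ℝ y u : ℝ) : ℂ) := by
    push_cast; ring
  simp only [norm_mul, this, norm_cexp_I_mul_ofReal, mul_one]

end Taylor

/-! ### Existence and Fourier representation of the derivatives of the local time -/

section LocalTime

variable {Ω : Type*} [MeasurableSpace Ω] {P : Measure Ω} {d : ℕ}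
  {X : ℝ≥0 → Ω → Space d} {U : ℝ → Ω → Space d} {T : ℝ} {x : Space d} {q : ℕ}

lemma TendstoLp.re {p : ℝ≥0∞} {F : ℝ → Ω → ℝ} {G : Ω → ℂ}
    (h : TendstoLp P p (fun ε ω => (F ε ω : ℂ)) G) : TendstoLp P p F (fun ω => (G ω).re) := by
  refine ⟨fun ε hε => by simpa using (h.1 ε hε).re, by simpa using h.2.1.re, ?_⟩
  refine tendsto_of_tendsto_of_tendsto_of_le_of_le tendsto_const_nhds h.2.2
    (fun _ => zero_le) fun ε => eLpNorm_mono fun ω => ?_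
  simpa using Complex.abs_re_le_norm ((F ε ω : ℂ) - G ω)

lemma isDominated_const_mul_symbol {k : Fin d → ℕ} (hk : order k ≤ q) (c : ℂ) :
    IsDominated (fun ξ : Space d => (1 + ‖ξ‖) ^ q) fun ξ => c * symbol k ξ := by
  refine ⟨(measurable_symbol k).const_mul c, ‖c‖, norm_nonneg _, fun ξ => ?_⟩
  rw [norm_mul]
  gcongr
  calc ‖symbol k ξ‖ ≤ ‖ξ‖ ^ order k := norm_symbol_le k ξ
    _ ≤ (1 + ‖ξ‖) ^ order k := by gcongr; linarith
    _ ≤ (1 + ‖ξ‖) ^ q := pow_le_pow_right₀ (by linarith [norm_nonneg ξ]) hk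

omit [MeasurableSpace Ω] in
lemma intervalIntegral_eq_of_version {V : Type*} [NormedAddCommGroup V] [NormedSpace ℝ V]
    (hT : 0 < T) {ω : Ω}
    (hω : ∀ᵐ t ∂(volume.restrict (Set.Ioc 0 T)), U t ω = X t.toNNReal ω + x)
    (φ : Space d → V) : ∫ t in (0 : ℝ)..T, φ (X t.toNNReal ω + x) =
      ∫ t, φ (U t ω) ∂(volume.restrict (Set.Ioc 0 T)) := by
  rw [intervalIntegral.integral_of_le hT.le]
  refine integral_congr_ae ?_
  filter_upwards [hω] with t ht
  rw [ht]

omit [MeasurableSpace Ω] in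
lemma localTimeApprox_eq_occ (hT : 0 < T) {ω : Ω}
    (hω : ∀ᵐ t ∂(volume.restrict (Set.Ioc 0 T)), U t ω = X t.toNNReal ω + x)
    (k : Fin d → ℕ) {ε : ℝ} (hε : 0 < ε) :
    ((localTimeApprox X k T x ε ω : ℝ) : ℂ) =
      occ (volume.restrict (Set.Ioc 0 T)) U (damp ε fun ξ => invConst d * symbol k ξ) ω := by
  rw [localTimeApprox, intervalIntegral_eq_of_version hT hω (multiDeriv k (heatKernel ε)),
    ← integral_complex_ofReal]
  simp only [multiDeriv_heatKernel hε]
  rfl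

/-- The derivatives of the local time exist and have the Fourier density `(2π)^{-d} (i ξ)^k`. -/
lemma IsMomentWeight.isLocalTimeDeriv [IsProbabilityMeasure P]
    (hw : IsMomentWeight P (volume.restrict (Set.Ioc 0 T)) U fun ξ => (1 + ‖ξ‖) ^ q)
    (hU : Measurable (fun z : ℝ × Ω => U z.1 z.2)) (hT : 0 < T)
    (hUX : ∀ᵐ ω ∂P, ∀ᵐ t ∂(volume.restrict (Set.Ioc 0 T)), U t ω = X t.toNNReal ω + x)
    {k : Fin d → ℕ} (hk : order k ≤ q) :
    IsLocalTimeDeriv P X k T x (localTimeDeriv P X k T x) ∧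
    IsGenOcc P (volume.restrict (Set.Ioc 0 T)) U (fun ξ => invConst d * symbol k ξ)
      (fun ω => ((localTimeDeriv P X k T x ω : ℝ) : ℂ)) := by
  have hae : ∀ ε, 0 < ε → occ (volume.restrict (Set.Ioc 0 T)) U
      (damp ε fun ξ => invConst d * symbol k ξ) =ᵐ[P]
        fun ω => ((localTimeApprox X k T x ε ω : ℝ) : ℂ) := by
    intro ε hε
    filter_upwards [hUX] with ω hω
    rw [localTimeApprox_eq_occ hT hω k hε]
  have hex : ∃ L, IsLocalTimeDeriv P X k T x L := by
    obtain ⟨L, hL⟩ := hw.exists_isGenOcc hU (isDominated_const_mul_symbol hk (invConst d))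
    exact ⟨fun ω => (L ω).re, fun p hp hp' =>
      ((hL p hp hp').congr hae (ae_eq_refl _)).re⟩
  have h1 : IsLocalTimeDeriv P X k T x (localTimeDeriv P X k T x) := by
    rw [localTimeDeriv, dif_pos hex]
    exact hex.choose_spec
  refine ⟨h1, fun p hp hp' => ?_⟩
  exact (tendstoLp_ofReal.mpr (h1 p hp hp')).congr (fun ε hε => (hae ε hε).symm) (ae_eq_refl _)

end LocalTime

/-! ### The expansion in powers of `s = √ε` -/

section Expansion

variable {Ω : Type*} [MeasurableSpace Ω] {P : Measure Ω} {d : ℕ}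
  {X : ℝ≥0 → Ω → Space d} {U : ℝ → Ω → Space d} {T : ℝ} {x : Space d}

/-- The Fourier density of the error in the expansion of order `N` at the scale `s`. -/
def errorDensity (k : Fin d → ℕ) (N : ℕ) (f : Space d → ℂ) (s : ℝ) (ξ : Space d) : ℂ :=
  (((s ^ N)⁻¹ : ℝ) : ℂ) * (invConst d * symbol k ξ * fourierHat f (s • ξ) -
      fourierHat f 0 * (invConst d * symbol k ξ)) -
    (-1 : ℂ) ^ N / (N.factorial : ℂ) *
      ∑ i : Fin N → Fin d, moment f i * (invConst d * symbol (shiftIndex k i) ξ)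

lemma errorDensity_eq (k : Fin d → ℕ) {N : ℕ} (hN : 1 ≤ N) {f : 𝓢(Space d, ℂ)}
    (hf : f ∈ schwartzVanishing d N) {s : ℝ} (hs : 0 < s) (ξ : Space d) :
    errorDensity k N f s ξ = invConst d * symbol k ξ *
      ((((s ^ N)⁻¹ : ℝ) : ℂ) * ∫ v, f v * expRem (N + 1) (-(s * inner ℝ ξ v))) := by
  rw [← fourierHat_taylor hN hf hs, errorDensity]
  have h1 : ∑ i : Fin N → Fin d, moment f i * (invConst d * symbol (shiftIndex k i) ξ) =
      invConst d * symbol k ξ *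
        ∑ i : Fin N → Fin d, (∏ j, (Complex.I * ((ξ (i j) : ℝ) : ℂ))) * moment f i := by
    rw [Finset.mul_sum]
    refine Finset.sum_congr rfl fun i _ => ?_
    rw [symbol_shiftIndex]
    ring
  rw [h1]
  ring

lemma measurable_errorDensity (k : Fin d → ℕ) (N : ℕ) (f : 𝓢(Space d, ℂ)) (s : ℝ) :
    Measurable (errorDensity k N f s) := by
  have h1 : Measurable fun ξ : Space d => fourierHat f (s • ξ) :=
    (continuous_fourierHat f).measurable.comp (measurable_const_smul s)
  have h2 := measurable_symbol k
  have h3 : ∀ i : Fin N → Fin d, Measurable (symbol (shiftIndex k i)) := fun i =>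
    measurable_symbol _
  unfold errorDensity
  fun_prop

/-- The remainder after order `N` is bounded by the power `N` only, so that `s^N` cancels and the
bound is uniform in `s`. This is the domination, and it fixes the degree `|k| + N` of the weight. -/
lemma exists_norm_errorDensity_le (k : Fin d → ℕ) {N : ℕ} (hN : 1 ≤ N) {f : 𝓢(Space d, ℂ)}
    (hf : f ∈ schwartzVanishing d N) :
    ∃ M : ℝ, 0 ≤ M ∧ ∀ s : ℝ, 0 < s → ∀ ξ : Space d,
      ‖errorDensity k N f s ξ‖ ≤ M * (1 + ‖ξ‖) ^ (order k + N) := by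
  obtain ⟨C, hC, hE⟩ := exists_norm_expRem_succ_le N
  refine ⟨‖invConst d‖ * (C * ∫ v, ‖v‖ ^ N * ‖f v‖), by positivity, fun s hs ξ => ?_⟩
  rw [errorDensity_eq k hN hf hs, norm_mul, norm_mul, norm_mul, Complex.norm_real,
    Real.norm_of_nonneg (by positivity)]
  have h1 := norm_integral_mul_comp_inner_le f hC hE hs.le ξ
  have h2 : ‖ξ‖ ^ order k * ‖ξ‖ ^ N ≤ (1 + ‖ξ‖) ^ (order k + N) := by
    rw [← pow_add]
    gcongr
    linarith
  calc ‖invConst d‖ * ‖symbol k ξ‖ *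
        ((s ^ N)⁻¹ * ‖∫ v, f v * expRem (N + 1) (-(s * inner ℝ ξ v))‖)
      ≤ ‖invConst d‖ * ‖ξ‖ ^ order k *
        ((s ^ N)⁻¹ * (s ^ N * (C * (∫ v, ‖v‖ ^ N * ‖f v‖)) * ‖ξ‖ ^ N)) := by
        gcongr
        exact norm_symbol_le k ξ
    _ = ‖invConst d‖ * (C * ∫ v, ‖v‖ ^ N * ‖f v‖) * (‖ξ‖ ^ order k * ‖ξ‖ ^ N) := by
        field_simp
    _ ≤ _ := by gcongr

/-- At a fixed frequency the sharp bound of order `N + 1` is affordable and leaves a factor `s`. -/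
lemma tendsto_errorDensity (k : Fin d → ℕ) {N : ℕ} (hN : 1 ≤ N) {f : 𝓢(Space d, ℂ)}
    (hf : f ∈ schwartzVanishing d N) (ξ : Space d) :
    Tendsto (fun s => errorDensity k N f s ξ) (𝓝[>] 0) (𝓝 0) := by
  obtain ⟨C, hC, hE⟩ := exists_norm_expRem_le (N + 1)
  rw [tendsto_zero_iff_norm_tendsto_zero]
  set A := ‖invConst d * symbol k ξ‖ *
    ((C * ∫ v, ‖v‖ ^ (N + 1) * ‖f v‖) * ‖ξ‖ ^ (N + 1)) with hA
  have h0 : Tendsto (fun s : ℝ => A * s) (𝓝[>] 0) (𝓝 0) := by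
    have : Continuous fun s : ℝ => A * s := by fun_prop
    simpa using (this.tendsto 0).mono_left nhdsWithin_le_nhds
  refine tendsto_of_tendsto_of_tendsto_of_le_of_le' tendsto_const_nhds h0
    (Eventually.of_forall fun _ => norm_nonneg _) ?_
  filter_upwards [self_mem_nhdsWithin] with s hs
  have hs : 0 < s := hs
  have h1 := norm_integral_mul_comp_inner_le f hC hE hs.le ξ
  rw [errorDensity_eq k hN hf hs, norm_mul, norm_mul _ (∫ v, _), Complex.norm_real,
    Real.norm_of_nonneg (by positivity)]
  calc ‖invConst d * symbol k ξ‖ *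
        ((s ^ N)⁻¹ * ‖∫ v, f v * expRem (N + 1) (-(s * inner ℝ ξ v))‖)
      ≤ ‖invConst d * symbol k ξ‖ * ((s ^ N)⁻¹ *
        (s ^ (N + 1) * (C * (∫ v, ‖v‖ ^ (N + 1) * ‖f v‖)) * ‖ξ‖ ^ (N + 1))) := by gcongr
    _ = A * s := by
        rw [hA, pow_succ s]
        field_simp

lemma isDominated_fourierHat_smul (k : Fin d → ℕ) {q : ℕ} (hk : order k ≤ q) (f : 𝓢(Space d, ℂ))
    (s : ℝ) : IsDominated (fun ξ : Space d => (1 + ‖ξ‖) ^ q)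
      fun ξ => invConst d * symbol k ξ * fourierHat f (s • ξ) := by
  obtain ⟨hm, M, hM, hb⟩ := isDominated_const_mul_symbol (d := d) hk (invConst d)
  refine ⟨hm.mul ((continuous_fourierHat f).measurable.comp (measurable_const_smul s)),
    M * ∫ u, ‖f u‖, by positivity, fun ξ => ?_⟩
  rw [norm_mul, mul_right_comm]
  gcongr
  · exact hb ξ
  · exact norm_fourierHat_le f _

omit [MeasurableSpace Ω] in
/-- The additive functional of a scaled Schwartz function in terms of Fourier densities. -/
lemma scaled_integral_eq_occ (hT : 0 < T) {ω : Ω}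
    (hω : ∀ᵐ t ∂(volume.restrict (Set.Ioc 0 T)), U t ω = X t.toNNReal ω + x)
    (f : 𝓢(Space d, ℂ)) (k : Fin d → ℕ) {r : ℝ} (hr : 0 < r) :
    (((r ^ (order k + d))⁻¹ : ℝ) : ℂ) *
        (∫ t in (0 : ℝ)..T, multiDeriv k (⇑f) (r⁻¹ • (X t.toNNReal ω + x))) =
      occ (volume.restrict (Set.Ioc 0 T)) U
        (fun ξ => invConst d * symbol k ξ * fourierHat f (r • ξ)) ω := by
  rw [intervalIntegral_eq_of_version hT hω fun y => multiDeriv k (⇑f) (r⁻¹ • y),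
    ← integral_const_mul]
  simp only [(multiDeriv_schwartz f k hr).2]
  rfl

/-- The expansion for a weight that admits moments. -/
lemma IsMomentWeight.tendstoLp_expansion [IsProbabilityMeasure P] {N : ℕ} {k : Fin d → ℕ}
    (hw : IsMomentWeight P (volume.restrict (Set.Ioc 0 T)) U fun ξ => (1 + ‖ξ‖) ^ (order k + N))
    (hU : Measurable (fun z : ℝ × Ω => U z.1 z.2)) (hT : 0 < T)
    (hUX : ∀ᵐ ω ∂P, ∀ᵐ t ∂(volume.restrict (Set.Ioc 0 T)), U t ω = X t.toNNReal ω + x)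
    (hN : 1 ≤ N) {f : 𝓢(Space d, ℂ)} (hf : f ∈ schwartzVanishing d N) {p : ℝ≥0∞} (hp : 1 ≤ p)
    (hp' : p ≠ ⊤) :
    TendstoLp P p
      (fun (ε : ℝ) (ω : Ω) => ((((ε ^ (1 / 2 : ℝ)) ^ N)⁻¹ : ℝ) : ℂ) *
        (((((ε ^ (1 / 2 : ℝ)) ^ (order k + d))⁻¹ : ℝ) : ℂ) *
            (∫ t in (0 : ℝ)..T,
              multiDeriv k (⇑f) ((ε ^ (1 / 2 : ℝ))⁻¹ • (X t.toNNReal ω + x)))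
          - fourierHat (⇑f) 0 * ((localTimeDeriv P X k T x ω : ℝ) : ℂ)))
      (fun ω : Ω => (-1 : ℂ) ^ N / (N.factorial : ℂ) *
        ∑ i : Fin N → Fin d,
          ((localTimeDeriv P X (shiftIndex k i) T x ω : ℝ) : ℂ) * moment (⇑f) i) := by
  set w : Space d → ℝ := fun ξ => (1 + ‖ξ‖) ^ (order k + N) with hw_def
  set μ := volume.restrict (Set.Ioc 0 T) with hμ
  have hkq : order k ≤ order k + N := Nat.le_add_right _ _
  have hL := (hw.isLocalTimeDeriv hU hT hUX hkq).2
  have hdk : IsDominated w fun ξ => invConst d * symbol k ξ :=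
    isDominated_const_mul_symbol hkq (invConst d)
  have hds : ∀ i : Fin N → Fin d, IsDominated w fun ξ =>
      invConst d * symbol (shiftIndex k i) ξ := fun i =>
    isDominated_const_mul_symbol (order_shiftIndex k i).le (invConst d)
  have hLs : ∀ i : Fin N → Fin d, IsGenOcc P μ U (fun ξ => invConst d * symbol (shiftIndex k i) ξ)
      (fun ω => ((localTimeDeriv P X (shiftIndex k i) T x ω : ℝ) : ℂ)) := fun i =>
    (hw.isLocalTimeDeriv hU hT hUX (order_shiftIndex k i).le).2
  have hsum := hw.isGenOcc_sum hU Finset.univ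
    (fun i => (hds i).const_mul (moment (⇑f) i)) (fun i => (hLs i).const_mul (moment (⇑f) i))
  have hG := hsum.2.const_mul ((-1 : ℂ) ^ N / (N.factorial : ℂ))
  have hdG := hsum.1.const_mul ((-1 : ℂ) ^ N / (N.factorial : ℂ))
  have hdh : ∀ s, IsDominated w fun ξ => invConst d * symbol k ξ * fourierHat f (s • ξ) :=
    fun s => isDominated_fourierHat_smul k hkq f s
  have hF : ∀ s, 0 < s → IsGenOcc P μ U
      (fun ξ => (((s ^ N)⁻¹ : ℝ) : ℂ) * ((fun ξ => invConst d * symbol k ξ *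
        fourierHat f (s • ξ)) - fun ξ => fourierHat f 0 * (invConst d * symbol k ξ)) ξ)
      (fun ω => (((s ^ N)⁻¹ : ℝ) : ℂ) * (occ μ U (fun ξ => invConst d * symbol k ξ *
        fourierHat f (s • ξ)) - fun ω => fourierHat f 0 *
          ((localTimeDeriv P X k T x ω : ℝ) : ℂ)) ω) := fun s hs =>
    (hw.isGenOcc_sub hU (hdh s) (hdk.const_mul _)
      (hw.isGenOcc_of_integrable hU (hdh s) (multiDeriv_schwartz f k hs).1)
      (hL.const_mul _)).const_mul _
  have hD : ∀ s, 0 < s → IsGenOcc P μ U (errorDensity k N f s) _ := fun s hs =>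
    hw.isGenOcc_sub hU (((hdh s).sub (hdk.const_mul _)).const_mul _) hdG (hF s hs) hG
  obtain ⟨M, hM, hb⟩ := exists_norm_errorDensity_le k hN hf
  have hlim := hw.tendsto_eLpNorm_isGenOcc hU hM (fun s _ => measurable_errorDensity k N f s)
    hb (tendsto_errorDensity k hN hf) hD hp hp'
  have hpos : ∀ {ε : ℝ}, 0 < ε → 0 < ε ^ (1 / 2 : ℝ) := fun hε => Real.rpow_pos_of_pos hε _
  -- The limit was taken in `s ↓ 0`; the substitution `s = √ε` turns it into the one in `ε`.
  have hscale : Tendsto (fun ε : ℝ => ε ^ (1 / 2 : ℝ)) (𝓝[>] 0) (𝓝[>] 0) := by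
    refine tendsto_nhdsWithin_iff.mpr ⟨?_, ?_⟩
    · have := (Real.continuousAt_rpow_const 0 (1 / 2 : ℝ) (Or.inr (by norm_num))).tendsto
      rw [Real.zero_rpow (by norm_num)] at this
      exact this.mono_left nhdsWithin_le_nhds
    · filter_upwards [self_mem_nhdsWithin] with ε hε
      exact hpos hε
  have main : TendstoLp P p
      (fun (ε : ℝ) ω => ((((ε ^ (1 / 2 : ℝ)) ^ N)⁻¹ : ℝ) : ℂ) *
        (occ μ U (fun ξ => invConst d * symbol k ξ * fourierHat f ((ε ^ (1 / 2 : ℝ)) • ξ)) -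
          fun ω => fourierHat f 0 * ((localTimeDeriv P X k T x ω : ℝ) : ℂ)) ω)
      (fun ω => (-1 : ℂ) ^ N / (N.factorial : ℂ) * ∑ i : Fin N → Fin d,
        moment (⇑f) i * ((localTimeDeriv P X (shiftIndex k i) T x ω : ℝ) : ℂ)) :=
    ⟨fun ε hε => (hF _ (hpos hε)).memLp hp hp', hG.memLp hp hp', hlim.comp hscale⟩
  refine main.congr (fun ε hε => ?_) (ae_of_all _ fun ω => ?_)
  · filter_upwards [hUX] with ω hω
    rw [scaled_integral_eq_occ hT hω f k (hpos hε)]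
    rfl
  · simp only [mul_comm (moment (⇑f) _)]

end Expansion

end LocalTimeLimit

end

open LocalTimeLimit
theorem theorem1p1 {Ω : Type*} [MeasurableSpace Ω] (P : Measure Ω) [IsProbabilityMeasure P]
    (d : ℕ) (hd : 1 ≤ d) (H : ℝ) (hH : H ∈ Set.Ioo (0 : ℝ) 1)
    (X : ℝ≥0 → Ω → Space d) (hX : MemG H X P)
    (N : ℕ) (hN : 1 ≤ N) (k : Fin d → ℕ)
    (hk : H * (2 * (order k : ℝ) + (d : ℝ)) < 1 - 2 * (N : ℝ) * H)
    (T : ℝ) (hT : 0 < T) (x : Space d) :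
    -- the derivatives of the local time that occur below exist
    IsLocalTimeDeriv P X k T x (localTimeDeriv P X k T x) ∧
    (∀ i : Fin N → Fin d,
      IsLocalTimeDeriv P X (shiftIndex k i) T x (localTimeDeriv P X (shiftIndex k i) T x)) ∧
    ∀ f ∈ schwartzVanishing d N, ∀ p : ℝ≥0∞, 1 ≤ p → p ≠ ⊤ →
      TendstoLp P p
        (fun (ε : ℝ) (ω : Ω) =>
          ((ε ^ (-(N : ℝ) / 2) : ℝ) : ℂ) *
            (((ε ^ (-((order k : ℝ) + (d : ℝ)) / 2) : ℝ) : ℂ) *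
                (∫ t in (0 : ℝ)..T,
                  multiDeriv k (⇑f) ((ε ^ (-(1 / 2) : ℝ)) • (X t.toNNReal ω + x)))
              - fourierHat (⇑f) 0 * ((localTimeDeriv P X k T x ω : ℝ) : ℂ)))
        (fun ω : Ω =>
          (-1 : ℂ) ^ N / (Nat.factorial N : ℂ) *
            ∑ i : Fin N → Fin d,
              ((localTimeDeriv P X (shiftIndex k i) T x ω : ℝ) : ℂ) * moment (⇑f) i) := by
  obtain ⟨U, hU, hUX, hUX'⟩ := hX.exists_measurable_version x T
  -- The assumption on `k` is precisely the moment condition for the weight of degree `|k| + N`,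
  -- which covers all the derivatives that occur.
  have hq : H * (2 * ((order k + N : ℕ) : ℝ) + d) < 1 := by
    push_cast
    linarith
  have hw := hX.isMomentWeight hH.1 hq hUX
  refine ⟨(hw.isLocalTimeDeriv hU hT hUX' (Nat.le_add_right _ _)).1,
    fun i => (hw.isLocalTimeDeriv hU hT hUX' (order_shiftIndex k i).le).1,
    fun f hf p hp hp' => ?_⟩
  refine (hw.tendstoLp_expansion hU hT hUX' hN hf hp hp').congr (fun ε hε => ?_) (ae_eq_refl _)
  have hpow : ∀ n : ℕ, ((ε ^ (1 / 2 : ℝ)) ^ n)⁻¹ = ε ^ (-(n : ℝ) / 2) := fun n => by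
    rw [← Real.rpow_natCast, ← Real.rpow_mul hε.le, ← Real.rpow_neg hε.le]
    congr 1
    ring
  simp only [hpow, Nat.cast_add, Real.rpow_neg hε.le]
  rfl
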